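/- Let $\mathcal H$ be a finite set of $K\ge 2$ hypotheses, $\mathcal A$ a finite set of actions, and for each $a\in\mathcal A$, $h\in\mathcal H$ let $P_h^a$ be a probability law on a measurable space $\mathcal O$ with density $p_a(\cdot\mid h)$ with respect to a $\sigma$-finite measure $\mu_a$. Assume that all $d_a(h,g):=\mathrm{KL}(P_h^a\|P_g^a)$ are finite and that for all $h\ne g$ there is $a$ with $d_a(h,g)>0$. Let $h^*\in\mathcal H$ be the true hypothesis, and assume that for some $v_M$, for all $a$ and all $g\neq h^*$, the variable $\log\frac{p_a(O\mid h^*)}{p_a(O\mid g)}-d_a(h^*,g)$, $O\sim P_{h^*}^a$, is sub-Gaussian with variance proxy $v_M$. For $\emptyset\ne S\subseteq\mathcal H\setminus\{h\}$ and $w$ in the simplex $\Delta(\mathcal A)$ put $f_S(w;h)=\min_{g\in S}\sum_a w_a d_a(h,g)$ and $D_0=\max_{w\in\Delta(\mathcal A)} f_{\mathcal H\setminus\{h^*\}}(w;h^*)$. Fix $b,c>0$; for $\alpha\in(0,1]$ and $\delta\in(0,1)$ let $L=\log(1/\delta)$ and $\beta(t)=\alpha L+b\log t+c$. Elimination-based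 Track-and-Stop: write $A_k$ and $O_k$ for the action and observation of round $k$. Given the past, $O_{t+1}$ has law $P_{h^*}^{A_{t+1}}$. Let $L_t(h)=\sum_{k\le t}\log p_{A_k}(O_k\mid h)$ and $Z_t(h,g)=L_t(h)-L_t(g)$. The champion $\hat h(t)$ maximizes $L_t$. The active-opponent sets are $$G_t(i)=\{g\ne i:\ Z_s(i,g)<\beta(s)\text{ for all }1\le s\le t\text{ with }\hat h(s)=i\}.$$ The algorithm stops at $\tau=\inf\{t\ge1: G_t(\hat h(t))=\emptyset\}$. Before stopping, the target $u(t)$ maximizes $f_{G_t(\hat h(t))}(\cdot\,;\hat h(t))$ on $\Delta(\mathcal A)$, and $A_{t+1}\in\arg\max_a\bigl(\sum_{s=1}^t u_a(s)-N_a(t)\bigr)$, where $N_a(t)$ is the number of selections of $a$ in rounds $1,\dots,t$. Ties are broken arbitrarily. An elimination chain is $\sigma=(\mathcal H\setminus\{h^*\}=S_0\supsetneq S_1\supsetneq\cdots\supsetneq S_m=\emptyset)$ (so $m\le K-1$). Its event $\mathcal E_\sigma$ is that $\tau<\infty$, $\hat h(\tau)=h^*$, and there are $0=T_0<T_1<\cdots<T_m=\tau$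 with $G_t(h^*)=S_k$ for $T_k\le t<T_{k+1}$, $0\le k<m$. Then there are constants $C_{1,\sigma},C_{2,\sigma},C_{3,\sigma}>0$, independent of $\alpha$ and $\delta$, such that for all $\alpha\in(0,1]$ and $\delta\in(0,1)$ and every run of the algorithm the following hold. The events $\mathcal E_\sigma$ are pairwise disjoint. For every chain $\sigma$, $$\mathbb E[\tau\mathbf 1_{\mathcal E_\sigma}]\le \Pr(\mathcal E_\sigma)\Bigl(\tfrac{\alpha L}{D_0}+\tfrac{b}{D_0}\log(1+L)+C_{1,\sigma}\sqrt{L\log(1+L)}+C_{2,\sigma}\log^2(1+L)\Bigr)+C_{3,\sigma}.$$ For every family $\mathfrak S$ of chains (in particular the family of all of them), with $\mathcal E_{\mathrm{corr}}=\bigcup_{\sigma\in\mathfrak S}\mathcal E_\sigma$, one has $\Pr(\mathcal E_{\mathrm{corr}})=\sum_{\sigma\in\mathfrak S}\Pr(\mathcal E_\sigma)$, $\mathbb E[\tau\mathbf 1_{\mathcal E_{\mathrm{corr}}}]=\sum_{\sigma\in\mathfrak S}\mathbb E[\tau\mathbf 1_{\mathcal E_\sigma}]$, and $$\mathbb E[\tau\mathbf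 1_{\mathcal E_{\mathrm{corr}}}]\le\Pr(\mathcal E_{\mathrm{corr}})\Bigl(\tfrac{\alpha L}{D_0}+\tfrac b{D_0}\log(1+L)\Bigr)+\sum_{\sigma\in\mathfrak S}\Pr(\mathcal E_\sigma)C_{1,\sigma}\sqrt{L\log(1+L)}+\sum_{\sigma\in\mathfrak S}\Pr(\mathcal E_\sigma)C_{2,\sigma}\log^2(1+L)+\sum_{\sigma\in\mathfrak S}C_{3,\sigma},$$ where $\sum_{\sigma\in\mathfrak S}C_{3,\sigma}$ is finite and does not depend on $\delta$. -/

import Mathlib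

open MeasureTheory ProbabilityTheory
open scoped NNReal ENNReal

/-- Active sensing model: finitely many hypotheses `H`, finitely many actions `A`, observations in
`O`. Under action `a` the observation laws of all hypotheses have densities `p a h` with respect to
a common σ-finite measure `ref a`. -/
structure SensingModel (H A O : Type*) [MeasurableSpace O] where
  ref : A → Measure O
  sigmaFinite_ref : ∀ a, SigmaFinite (ref a)
  p : A → H → O → ℝ
  measurable_p : ∀ a h, Measurable (p a h)
  p_nonneg : ∀ a h o, 0 ≤ p a h o
  lintegral_p : ∀ a h, ∫⁻ o, ENNReal.ofReal (p a h o) ∂(ref a) = 1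

namespace SensingModel

variable {H A O : Type*} [MeasurableSpace O]

/-- The law `P_h^a` of one observation under action `a` if `h` is true. -/
noncomputable def law (M : SensingModel H A O) (a : A) (h : H) : Measure O :=
  (M.ref a).withDensity fun o => ENNReal.ofReal (M.p a h o)

/-- The divergence `d_a(h, g) = KL(P_h^a ‖ P_g^a)`. -/
noncomputable def d (M : SensingModel H A O) (a : A) (h g : H) : ℝ :=
  (InformationTheory.klDiv (M.law a h) (M.law a g)).toReal

/-- All the divergences `d_a(h, g)` are finite, so that they are real numbers. -/
def FiniteDivergence (M : SensingModel H A O) : Prop :=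
  ∀ a h g, InformationTheory.klDiv (M.law a h) (M.law a g) ≠ ⊤

/-- Any two distinct hypotheses are distinguished by some action. -/
def Identifiable (M : SensingModel H A O) : Prop :=
  ∀ h g, h ≠ g → ∃ a, 0 < M.d a h g

/-- If `h` is true, then under every action the centred log-likelihood ratio of `h` against any
other hypothesis is sub-Gaussian with variance proxy `v`. -/
def SubGaussianIncrements (M : SensingModel H A O) (h : H) (v : ℝ≥0) : Prop :=
  ∀ a g, g ≠ h →
    HasSubgaussianMGF (fun o => Real.log (M.p a h o / M.p a g o) - M.d a h g) v (M.law a h)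

variable [Fintype A]

/-- Worst-case information rate `f_S(w; h) = min_{g ∈ S} ∑_a w_a d_a(h, g)` (used for `S ≠ ∅`). -/
noncomputable def rate (M : SensingModel H A O) (h : H) (S : Finset H) (w : A → ℝ) : ℝ :=
  ⨅ g : S, ∑ a, w a * M.d a h g

/-- `w` is an oracle allocation for `h` against `S`: a maximizer of `f_S(·; h)` on the simplex. -/
def IsOracle (M : SensingModel H A O) (h : H) (S : Finset H) (w : A → ℝ) : Prop :=
  w ∈ stdSimplex ℝ A ∧ ∀ w' ∈ stdSimplex ℝ A, M.rate h S w' ≤ M.rate h S w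

/-- Oracle information rate `D^*(h; S) = max_w f_S(w; h)`. -/
noncomputable def oracleRate (M : SensingModel H A O) (h : H) (S : Finset H) : ℝ :=
  ⨆ w : stdSimplex ℝ A, M.rate h S w

/-- The base rate `D_0 = D^*(h; H \ {h})`. -/
noncomputable def baseRate [Fintype H] [DecidableEq H] (M : SensingModel H A O) (h : H) : ℝ :=
  M.oracleRate h (Finset.univ.erase h)

end SensingModel

/-- Elimination threshold `β_elim(t, δ) = α log (1/δ) + b log t + c`. -/
noncomputable def elimThreshold (b c α δ : ℝ) (t : ℕ) : ℝ :=
  α * Real.log (1 / δ) + b * Real.log t + c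

/-- A sample path: actions and observations of the rounds `1, 2, …` (the entries at `0` are not
used), and the champions after `0, 1, 2, …` rounds. -/
structure SamplePath (H A O : Type*) where
  act : ℕ → A
  obs : ℕ → O
  champ : ℕ → H

namespace SamplePath

variable {H A O : Type*} [MeasurableSpace O]

/-- Cumulative log-likelihood `L_t(h)`. -/
noncomputable def logLik (M : SensingModel H A O) (x : SamplePath H A O) (t : ℕ) (h : H) : ℝ :=
  ∑ k ∈ Finset.Icc 1 t, Real.log (M.p (x.act k) h (x.obs k))

/-- Log-likelihood ratio `Z_t(h, g)`. -/
noncomputable def llr (M : SensingModel H A O) (x : SamplePath H A O) (t : ℕ) (h g : H) : ℝ :=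
  x.logLik M t h - x.logLik M t g

open Classical in
/-- The number `N_a(t)` of rounds up to `t` in which `a` was selected. -/
noncomputable def count (x : SamplePath H A O) (a : A) (t : ℕ) : ℕ :=
  ((Finset.Icc 1 t).filter fun k => x.act k = a).card

variable [Fintype H]

open Classical in
/-- Active-opponent set `G_t(i)`: the opponents of `i` not yet eliminated in any of the rounds
`1, …, t` after which `i` was the champion. -/
noncomputable def active (M : SensingModel H A O) (b c α δ : ℝ) (x : SamplePath H A O) (t : ℕ)
    (i : H) : Finset H :=
  Finset.univ.filter fun g =>
    g ≠ i ∧ ∀ s, 1 ≤ s → s ≤ t → x.champ s = i → x.llr M s i g < elimThreshold b c α δ s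

/-- The stopping time `τ`: the first round `t ≥ 1` after which the active-opponent set of the
current champion is empty (`⊤` if there is none). -/
noncomputable def stopTime (M : SensingModel H A O) (b c α δ : ℝ) (x : SamplePath H A O) : ℕ∞ :=
  ⨅ (t : ℕ) (_ : 1 ≤ t ∧ x.active M b c α δ t (x.champ t) = ∅), (t : ℕ∞)

end SamplePath

/-- An elimination chain `S_0 ⊋ S_1 ⊋ ⋯ ⊋ S_m = ∅` with `S_0 = H \ {h}`. Here `m ≤ |H| - 1`,
with equality if and only if the opponents are eliminated one at a time. -/
structure ElimChain {H : Type*} [Fintype H] [DecidableEq H] (h : H) where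
  len : ℕ
  S : Fin (len + 1) → Finset H
  start : S 0 = Finset.univ.erase h
  finish : S (Fin.last len) = ∅
  anti : StrictAnti S

namespace ElimChain

variable {H : Type*} [Fintype H] [DecidableEq H] {h : H}

theorem len_lt (σ : ElimChain h) : σ.len < Fintype.card (Finset H) := by
  have := Fintype.card_le_of_injective σ.S σ.anti.injective
  simpa using this

instance : Finite (ElimChain h) := by
  let f : ElimChain h →
      (Σ n : Fin (Fintype.card (Finset H)), (Fin ((n : ℕ) + 1) → Finset H)) :=
    fun σ => ⟨⟨σ.len, σ.len_lt⟩, σ.S⟩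
  refine Finite.of_injective f ?_
  rintro ⟨n, S, _, _, _⟩ ⟨n', S', _, _, _⟩ e
  simp only [f, Sigma.mk.injEq, Fin.mk.injEq] at e
  obtain ⟨rfl, e⟩ := e
  cases e
  rfl

/-- There are only finitely many chains. -/
noncomputable instance : Fintype (ElimChain h) := Fintype.ofFinite _

end ElimChain

/-- The path stops with champion `h`, and up to then `G_t(h)` runs through the chain `σ`: there are
`0 = T_0 < T_1 < ⋯ < T_m = τ` such that `G_t(h) = S_k` from `T_k` until just before `T_{k+1}`. -/
def SamplePath.Follows {H A O : Type*} [MeasurableSpace O] [Fintype H] [DecidableEq H] {h : H}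
    (M : SensingModel H A O) (b c α δ : ℝ) (σ : ElimChain h) (x : SamplePath H A O) : Prop :=
  ∃ T : Fin (σ.len + 1) → ℕ, StrictMono T ∧ T 0 = 0 ∧
    x.stopTime M b c α δ = (T (Fin.last σ.len) : ℕ∞) ∧
    x.champ (T (Fin.last σ.len)) = h ∧
    ∀ k : Fin σ.len, ∀ t : ℕ, T k.castSucc ≤ t → t < T k.succ →
      x.active M b c α δ t h = σ.S k.castSucc

/-- A run, on the probability space `(Ω, P)`, of Track-and-Stop with adaptive elimination when `h`
is the true hypothesis. Ties are broken arbitrarily. The sampling rule is imposed only as long as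
the algorithm has not stopped. -/
structure ElimTaS {H A O : Type*} [MeasurableSpace O] [Fintype H] [Fintype A]
    (M : SensingModel H A O) (h : H) (b c α δ : ℝ)
    (Ω : Type*) [mΩ : MeasurableSpace Ω] (P : Measure Ω) where
  /-- the information after each round -/
  ℱ : Filtration ℕ mΩ
  path : Ω → SamplePath H A O
  /-- the tracked target `u(t)` -/
  target : Ω → ℕ → A → ℝ
  act_meas : ∀ t a, MeasurableSet[ℱ t] {ω | (path ω).act (t + 1) = a}
  obs_meas : ∀ t, Measurable[ℱ (t + 1)] fun ω => (path ω).obs (t + 1)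
  champ_meas : ∀ t i, MeasurableSet[ℱ t] {ω | (path ω).champ t = i}
  /-- given the past, the next observation has law `P_h^a`, with `a` the selected action -/
  obs_law : ∀ (t : ℕ) (B : Set O), MeasurableSet B →
    P[((fun ω => (path ω).obs (t + 1)) ⁻¹' B).indicator (fun _ => (1 : ℝ)) | ℱ t]
      =ᵐ[P] fun ω => (M.law ((path ω).act (t + 1)) h).real B
  /-- the champion maximizes the likelihood -/
  champ_max : ∀ ω t g, (path ω).logLik M t g ≤ (path ω).logLik M t ((path ω).champ t)
  /-- the target is an oracle allocation of the champion against its active opponents -/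
  target_oracle : ∀ ω (t : ℕ), (t : ℕ∞) < (path ω).stopTime M b c α δ →
    M.IsOracle ((path ω).champ t) ((path ω).active M b c α δ t ((path ω).champ t)) (target ω t)
  /-- C-Tracking: the next action maximizes cumulative target minus number of selections -/
  tracking : ∀ ω (t : ℕ), (t : ℕ∞) < (path ω).stopTime M b c α δ → ∀ a,
    (∑ s ∈ Finset.Icc 1 t, target ω s a) - ((path ω).count a t : ℝ) ≤
      (∑ s ∈ Finset.Icc 1 t, target ω s ((path ω).act (t + 1)))
        - ((path ω).count ((path ω).act (t + 1)) t : ℝ)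

namespace ElimTaS

variable {H A O : Type*} [MeasurableSpace O] [Fintype H] [Fintype A]
  {M : SensingModel H A O} {h : H} {b c α δ : ℝ}
  {Ω : Type*} [MeasurableSpace Ω] {P : Measure Ω}

/-- The stopping time `τ` of the run. -/
noncomputable def τ (X : ElimTaS M h b c α δ Ω P) (ω : Ω) : ℕ∞ :=
  (X.path ω).stopTime M b c α δ

/-- The chain event `E_σ`. -/
def chainEvent [DecidableEq H] (X : ElimTaS M h b c α δ Ω P) (σ : ElimChain h) : Set Ω :=
  {ω | (X.path ω).Follows M b c α δ σ}

/-- The correct-elimination event `E_corr` of a family of chains: the union of their events. -/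
def corrEvent [DecidableEq H] (X : ElimTaS M h b c α δ Ω P) (F : Finset (ElimChain h)) : Set Ω :=
  ⋃ σ ∈ F, X.chainEvent σ

/-- `E[τ 1_E]`, as an element of `[0, ∞]`. -/
noncomputable def expTime (X : ElimTaS M h b c α δ Ω P) (E : Set Ω) : ℝ≥0∞ :=
  ∫⁻ ω, E.indicator (fun ω => (X.τ ω : ℝ≥0∞)) ω ∂P

end ElimTaS

/-! The chain plays no part in bounding the duration. There are random variables `Y`, `R ≥ 0`, with
expectations bounded uniformly in `α` and `δ`, such that every `t < τ` satisfies `t ≤ αL / D₀ + C₁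
√(L log (1 + L)) + C₂ (1 + Y + R)` on each path. Over a chain event the deterministic part
integrates to its multiple by the probability of the event; `Y` and `R` are integrated over the
whole space, so nothing has to be conditioned on the event. The terms in `log (1 + L)` and `log² (1
+ L)` only weaken this bound, and one set of constants serves all chains.

Rounds with the true champion (`baseRate_mul_le`): at the last such round before stopping some
opponent `g` is still active, and by monotonicity it was active in all earlier ones. Each of their
targets therefore carries information at least `D₀` against `g`, because a minimum over fewer
opponents is larger. C-tracking turns this into accumulated divergence up to a constant. The
log-likelihood ratio is still below the threshold, and it falls short of the divergence by at most
`deviationRadius` plus `R` (`exists_shortfall_bound`).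

Rounds with a wrong champion `i` number `O(Y + log t + 1)`. By `exists_surplus_bound`, derived from
Ville's inequality, the number of rounds that distinguish the truth from any `g` is at most a
multiple of the log-likelihood ratio plus `Y`, at all times at once. If the truth is active for `i`,
the targets force such rounds, whereas the ratio is nonpositive under champion `i`. If `i` has
eliminated the truth, this very error bounds `αL` by a multiple of `Y`; another opponent `g` of `i`
is active, and an action separating `i` from `g` separates the truth from one of the two.

The logarithm is absorbed into `√(t log (1 + t))`, and `exists_explicit_bound` solves the resulting
implicit inequality. Disjointness holds because the path up to `τ` determines the range of the
chain, hence the chain. -/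

namespace SensingModel

/-! ### Laws and log-likelihood ratios of a single observation -/

section Laws

variable {H A O : Type*} [MeasurableSpace O] (M : SensingModel H A O)

instance isProbabilityMeasure_law (a : A) (h : H) : IsProbabilityMeasure (M.law a h) :=
  ⟨by rw [law, withDensity_apply _ MeasurableSet.univ, Measure.restrict_univ, M.lintegral_p]⟩

lemma d_nonneg (a : A) (h g : H) : 0 ≤ M.d a h g := ENNReal.toReal_nonneg

/-- Finiteness is needed because `toReal` also sends `⊤` to `0`. -/
lemma d_eq_zero_iff (hfin : M.FiniteDivergence) (a : A) (h g : H) :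
    M.d a h g = 0 ↔ M.law a h = M.law a g := by
  rw [d, ENNReal.toReal_eq_zero_iff, or_iff_left (hfin a h g),
    InformationTheory.klDiv_eq_zero_iff]

lemma ae_p_pos_self (a : A) (h : H) : ∀ᵐ o ∂M.law a h, 0 < M.p a h o := by
  rw [ae_iff, law, withDensity_apply_eq_zero (M.measurable_p a h).ennreal_ofReal]
  convert measure_empty (μ := M.ref a)
  ext o
  simp +contextual

/-- A finite divergence forces absolute continuity. Positivity of both densities matters because
`Real.log 0 = 0`: only then is the difference of logarithms the logarithm of the quotient. -/
lemma ae_p_pos (hfin : M.FiniteDivergence) (a : A) (h g : H) :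
    ∀ᵐ o ∂M.law a h, 0 < M.p a g o :=
  (InformationTheory.klDiv_ne_top_iff.1 (hfin a h g)).1.ae_le (M.ae_p_pos_self a g)

/-- The log-likelihood ratio of a single observation. -/
noncomputable def logRatio (a : A) (h g : H) (o : O) : ℝ :=
  Real.log (M.p a h o) - Real.log (M.p a g o)

lemma measurable_logRatio (a : A) (h g : H) : Measurable (M.logRatio a h g) :=
  (M.measurable_p a h).log.sub (M.measurable_p a g).log

lemma logRatio_ae_eq (hfin : M.FiniteDivergence) (a : A) (h g : H) :
    M.logRatio a h g =ᵐ[M.law a h] fun o => Real.log (M.p a h o / M.p a g o) := by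
  filter_upwards [M.ae_p_pos_self a h, M.ae_p_pos hfin a h g] with o h1 h2
  rw [logRatio, Real.log_div h1.ne' h2.ne']

/-- Densities with respect to a σ-finite measure are unique up to null sets. Hence an uninformative
action almost surely leaves the log-likelihood ratio unchanged. -/
lemma logRatio_ae_eq_zero (a : A) (h g : H) (hlaw : M.law a h = M.law a g) :
    M.logRatio a h g =ᵐ[M.law a h] 0 := by
  have := M.sigmaFinite_ref a
  have h1 : (fun o => ENNReal.ofReal (M.p a h o)) =ᵐ[M.ref a]
      fun o => ENNReal.ofReal (M.p a g o) :=
    (withDensity_eq_iff_of_sigmaFinite (M.measurable_p a h).ennreal_ofReal.aemeasurable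
      (M.measurable_p a g).ennreal_ofReal.aemeasurable).1 hlaw
  filter_upwards [(withDensity_absolutelyContinuous _ _).ae_le h1] with o ho
  rw [ENNReal.ofReal_eq_ofReal_iff (M.p_nonneg _ _ _) (M.p_nonneg _ _ _)] at ho
  simp [logRatio, ho]

lemma lintegral_exp_logRatio_le (hfin : M.FiniteDivergence) {h : H} {v : ℝ≥0}
    (hv : M.SubGaussianIncrements h v) (a : A) {g : H} (hg : g ≠ h) (θ : ℝ) :
    ∫⁻ o, ENNReal.ofReal (Real.exp (θ * M.logRatio a h g o)) ∂M.law a h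
      ≤ ENNReal.ofReal (Real.exp (θ * M.d a h g + v * θ ^ 2 / 2)) := by
  have hs := hv a g hg
  calc ∫⁻ o, ENNReal.ofReal (Real.exp (θ * M.logRatio a h g o)) ∂M.law a h
      = ∫⁻ o, ENNReal.ofReal (Real.exp (θ * M.d a h g)) * ENNReal.ofReal
          (Real.exp (θ * (Real.log (M.p a h o / M.p a g o) - M.d a h g))) ∂M.law a h := by
        refine lintegral_congr_ae ?_
        filter_upwards [M.logRatio_ae_eq hfin a h g] with o ho
        rw [ho, ← ENNReal.ofReal_mul (Real.exp_pos _).le, ← Real.exp_add]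
        ring_nf
    _ = ENNReal.ofReal (Real.exp (θ * M.d a h g)) * ENNReal.ofReal
          (mgf (fun o => Real.log (M.p a h o / M.p a g o) - M.d a h g) (M.law a h) θ) := by
        rw [lintegral_const_mul' _ _ ENNReal.ofReal_ne_top, mgf,
          ofReal_integral_eq_lintegral_ofReal (hs.integrable_exp_mul θ)
            (Filter.Eventually.of_forall fun _ => (Real.exp_pos _).le)]
    _ ≤ ENNReal.ofReal (Real.exp (θ * M.d a h g)) * ENNReal.ofReal
          (Real.exp (v * θ ^ 2 / 2)) := by
        gcongr
        exact hs.mgf_le θ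
    _ = _ := by rw [← ENNReal.ofReal_mul (Real.exp_pos _).le, ← Real.exp_add]

lemma lintegral_exp_logRatio_of_d_eq_zero (hfin : M.FiniteDivergence) {h : H} (a : A) {g : H}
    (hd : M.d a h g = 0) (θ : ℝ) :
    ∫⁻ o, ENNReal.ofReal (Real.exp (θ * M.logRatio a h g o)) ∂M.law a h = 1 := by
  have h0 := M.logRatio_ae_eq_zero a h g ((M.d_eq_zero_iff hfin a h g).1 hd)
  rw [lintegral_congr_ae (g := fun _ => 1)]
  · simp
  · filter_upwards [h0] with o ho
    simp [ho]

end Laws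

/-! ### Information rates and oracle allocations -/

section Rates

variable {H A O : Type*} [MeasurableSpace O] [Fintype H] [Fintype A] (M : SensingModel H A O)

lemma exists_d_lower : ∃ ε > 0, ∀ a h g, 0 < M.d a h g → ε ≤ M.d a h g := by
  classical
  let s : Finset ℝ :=
    (Finset.univ.image fun q : A × H × H => M.d q.1 q.2.1 q.2.2).filter fun r => 0 < r
  by_cases hs : s.Nonempty
  · refine ⟨s.min' hs, (Finset.mem_filter.1 (s.min'_mem hs)).2, fun a h g hd => s.min'_le _ ?_⟩
    exact Finset.mem_filter.2 ⟨Finset.mem_image.2 ⟨(a, h, g), Finset.mem_univ _, rfl⟩, hd⟩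
  · refine ⟨1, one_pos, fun a h g hd => (hs ⟨M.d a h g, ?_⟩).elim⟩
    exact Finset.mem_filter.2 ⟨Finset.mem_image.2 ⟨(a, h, g), Finset.mem_univ _, rfl⟩, hd⟩

lemma exists_d_upper : ∃ B > 0, ∀ a h g, M.d a h g ≤ B := by
  refine ⟨1 + ∑ q : A × H × H, M.d q.1 q.2.1 q.2.2, ?_, fun a h g => ?_⟩
  · have := Finset.sum_nonneg fun (q : A × H × H) (_ : q ∈ Finset.univ) =>
      M.d_nonneg q.1 q.2.1 q.2.2
    linarith
  · have := Finset.single_le_sum (f := fun q : A × H × H => M.d q.1 q.2.1 q.2.2)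
      (fun q _ => M.d_nonneg q.1 q.2.1 q.2.2) (Finset.mem_univ (a, h, g))
    simp only at this
    linarith

omit [Fintype H] in
lemma rate_le (h : H) {S : Finset H} {g : H} (hg : g ∈ S) (w : A → ℝ) :
    M.rate h S w ≤ ∑ a, w a * M.d a h g :=
  ciInf_le (Set.finite_range fun g : S => ∑ a, w a * M.d a h g).bddBelow ⟨g, hg⟩

omit [Fintype H] in
lemma le_rate (h : H) {S : Finset H} (hS : S.Nonempty) (w : A → ℝ) (r : ℝ)
    (hr : ∀ g ∈ S, r ≤ ∑ a, w a * M.d a h g) : r ≤ M.rate h S w := by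
  have := hS.to_subtype
  exact le_ciInf fun g => hr g g.2

/-- The uniform allocation gives every distinguishing action weight `1 / |A|`, and finitely many
positive divergences have a positive lower bound. -/
lemma exists_uniform_rate (hid : M.Identifiable) [Nonempty A] :
    ∃ ε > 0, ∃ w ∈ stdSimplex ℝ A, ∀ (i : H) (S : Finset H), S.Nonempty → i ∉ S →
      ε ≤ M.rate i S w := by
  obtain ⟨ε, hε, hlow⟩ := M.exists_d_lower
  have hA : (0 : ℝ) < Fintype.card A := by exact_mod_cast Fintype.card_pos
  refine ⟨(Fintype.card A : ℝ)⁻¹ * ε, by positivity, fun _ => (Fintype.card A : ℝ)⁻¹,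
    ⟨fun _ => by positivity, by simp⟩, fun i S hS hi => M.le_rate i hS _ _ fun g hg => ?_⟩
  obtain ⟨a, ha⟩ := hid i g fun e => hi (e ▸ hg)
  calc (Fintype.card A : ℝ)⁻¹ * ε ≤ (Fintype.card A : ℝ)⁻¹ * M.d a i g := by
        gcongr
        exact hlow a i g ha
    _ ≤ _ := Finset.single_le_sum (f := fun a => (Fintype.card A : ℝ)⁻¹ * M.d a i g)
        (fun a _ => mul_nonneg (by positivity) (M.d_nonneg _ _ _)) (Finset.mem_univ a)

lemma exists_oracle_lower (hid : M.Identifiable) [Nonempty A] :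
    ∃ ε > 0, ∀ (i : H) (S : Finset H) (w : A → ℝ), i ∉ S → M.IsOracle i S w → ∀ g ∈ S,
      ε ≤ ∑ a, w a * M.d a i g := by
  obtain ⟨ε, hε, w, hw, hr⟩ := M.exists_uniform_rate hid
  exact ⟨ε, hε, fun i S u hi hu g hg =>
    ((hr i S ⟨g, hg⟩ hi).trans (hu.2 w hw)).trans (M.rate_le i hg u)⟩

variable [DecidableEq H]

omit [Fintype H] [DecidableEq H] in
lemma rate_bddAbove (h : H) {S : Finset H} (hS : S.Nonempty) :
    BddAbove (Set.range fun w : stdSimplex ℝ A => M.rate h S w) := by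
  obtain ⟨g, hg⟩ := hS
  refine ⟨∑ a, M.d a h g, ?_⟩
  rintro _ ⟨w, rfl⟩
  refine (M.rate_le h hg w).trans (Finset.sum_le_sum fun a _ => ?_)
  have h1 : w.1 a ≤ 1 := by
    rw [← w.2.2]
    exact Finset.single_le_sum (fun b _ => w.2.1 b) (Finset.mem_univ a)
  exact mul_le_of_le_one_left (M.d_nonneg _ _ _) h1

lemma baseRate_pos [Nontrivial H] (hid : M.Identifiable) [Nonempty A] (h : H) :
    0 < M.baseRate h := by
  obtain ⟨ε, hε, w, hw, hr⟩ := M.exists_uniform_rate hid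
  obtain ⟨g, hg⟩ := exists_ne h
  have hS : (Finset.univ.erase h).Nonempty := ⟨g, by simp [hg]⟩
  exact hε.trans_le ((hr h _ hS (by simp)).trans (le_ciSup (M.rate_bddAbove h hS) ⟨w, hw⟩))

/-- Discarding opponents can only raise the worst-case rate of each allocation, hence also its
maximum. This is why elimination never costs more than the base rate. -/
lemma baseRate_le [Nonempty A] (h : H) {S : Finset H} (hh : h ∉ S) {w : A → ℝ}
    (hw : M.IsOracle h S w) {g : H} (hg : g ∈ S) :
    M.baseRate h ≤ ∑ a, w a * M.d a h g := by
  refine le_trans ?_ (M.rate_le h hg w)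
  have : Nonempty (stdSimplex ℝ A) := inferInstance
  refine ciSup_le fun w' => le_trans ?_ (hw.2 w' w'.2)
  refine M.le_rate h ⟨g, hg⟩ _ _ fun g' hg' => M.rate_le h ?_ _
  simpa using fun e : g' = h => hh (e ▸ hg')

end Rates

end SensingModel

/-! ### Conditional law of the next observation, exponential weights and Ville's inequality -/

namespace ElimTaS

variable {H A O : Type*} [MeasurableSpace O] [Fintype H] [Fintype A]
  {M : SensingModel H A O} {h : H} {b c α δ : ℝ}
  {Ω : Type*} [mΩ : MeasurableSpace Ω] {P : Measure Ω}

/-- On a past event where the next action is constant, the conditional law is constant too, so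
integrating the conditional expectation over the event factorizes. -/
lemma map_obs_restrict [IsProbabilityMeasure P] (X : ElimTaS M h b c α δ Ω P) (t : ℕ) (a : A)
    {S : Set Ω} (hS : MeasurableSet[X.ℱ t] S) (hSa : ∀ ω ∈ S, (X.path ω).act (t + 1) = a) :
    (P.restrict S).map (fun ω => (X.path ω).obs (t + 1)) = P S • M.law a h := by
  have hobs : Measurable fun ω => (X.path ω).obs (t + 1) :=
    (X.obs_meas t).mono (X.ℱ.le _) le_rfl
  have hS' := X.ℱ.le t S hS
  ext B hB
  have hB' := hobs hB
  rw [Measure.map_apply hobs hB, Measure.restrict_apply hB', Measure.smul_apply, smul_eq_mul]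
  have hc := setIntegral_condExp (μ := P) (X.ℱ.le t)
    ((integrable_const (1 : ℝ)).indicator hB') hS
  rw [setIntegral_congr_ae hS' ((X.obs_law t B hB).mono fun ω hω _ => hω),
    setIntegral_congr_fun hS' (g := fun _ => (M.law a h).real B)
      (fun ω hω => by simp only [hSa ω hω]),
    setIntegral_const, integral_indicator_const _ hB', smul_eq_mul, smul_eq_mul, mul_one,
    measureReal_restrict_apply hB'] at hc
  rw [← ENNReal.toReal_eq_toReal_iff' (measure_ne_top _ _)
    (ENNReal.mul_ne_top (measure_ne_top _ _) (measure_ne_top _ _)), ENNReal.toReal_mul]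
  exact hc.symm

lemma setLIntegral_mul_obs [IsProbabilityMeasure P] (X : ElimTaS M h b c α δ Ω P) (t : ℕ) (a : A)
    {S : Set Ω} (hS : MeasurableSet[X.ℱ t] S) (hSa : ∀ ω ∈ S, (X.path ω).act (t + 1) = a)
    {f : O → ℝ≥0∞} (hf : Measurable f) {G : Ω → ℝ≥0∞} (hG : Measurable[X.ℱ t] G) :
    ∫⁻ ω in S, G ω * f ((X.path ω).obs (t + 1)) ∂P
      = (∫⁻ ω in S, G ω ∂P) * ∫⁻ o, f o ∂M.law a h := by
  have hobs : Measurable fun ω => (X.path ω).obs (t + 1) :=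
    (X.obs_meas t).mono (X.ℱ.le _) le_rfl
  have hfo : Measurable fun ω => f ((X.path ω).obs (t + 1)) := hf.comp hobs
  refine @Measurable.ennreal_induction Ω (X.ℱ t)
    (fun G => ∫⁻ ω in S, G ω * f ((X.path ω).obs (t + 1)) ∂P
      = (∫⁻ ω in S, G ω ∂P) * ∫⁻ o, f o ∂M.law a h) ?_ ?_ ?_ G hG
  · intro r s hs
    have hs' := X.ℱ.le t s hs
    have h1 := X.map_obs_restrict t a (hs.inter hS) (fun ω hω => hSa ω hω.2)
    have h2 : ∀ ω, s.indicator (fun _ => r) ω * f ((X.path ω).obs (t + 1))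
        = s.indicator (fun ω => r * f ((X.path ω).obs (t + 1))) ω := fun ω => by
      by_cases hω : ω ∈ s <;> simp [hω]
    simp_rw [h2]
    rw [lintegral_indicator hs', lintegral_indicator hs', setLIntegral_const,
      Measure.restrict_restrict hs', lintegral_const_mul _ hfo,
      ← lintegral_map (μ := P.restrict (s ∩ S)) hf hobs, h1, lintegral_smul_measure,
      Measure.restrict_apply hs', smul_eq_mul, mul_assoc]
  · intro f₁ f₂ _ h1 h2 ih1 ih2
    have h1' := h1.mono (X.ℱ.le t) le_rfl
    simp only [Pi.add_apply, add_mul]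
    have h3 : Measurable fun ω => f₁ ω * f ((X.path ω).obs (t + 1)) := h1'.mul hfo
    rw [lintegral_add_left h3, ih1, ih2, lintegral_add_left h1', add_mul]
  · intro u hu hmono ih
    have hu' := fun n => (hu n).mono (X.ℱ.le t) le_rfl
    simp_rw [ENNReal.iSup_mul]
    have h3 : ∀ n, Measurable fun ω => u n ω * f ((X.path ω).obs (t + 1)) :=
      fun n => (hu' n).mul hfo
    rw [lintegral_iSup h3 (fun i j hij ω => mul_le_mul_left (hmono hij ω) _),
      lintegral_iSup hu' hmono, ENNReal.iSup_mul]
    simp_rw [ih]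

/-- Product of per-round weights along a path. -/
noncomputable def weight (X : ElimTaS M h b c α δ Ω P) (w : A → O → ℝ≥0∞) (t : ℕ) (ω : Ω) :
    ℝ≥0∞ :=
  ∏ k ∈ Finset.Icc 1 t, w ((X.path ω).act k) ((X.path ω).obs k)

lemma weight_zero (X : ElimTaS M h b c α δ Ω P) (w : A → O → ℝ≥0∞) (ω : Ω) :
    X.weight w 0 ω = 1 := by simp [weight]

lemma weight_succ (X : ElimTaS M h b c α δ Ω P) (w : A → O → ℝ≥0∞) (t : ℕ) (ω : Ω) :
    X.weight w (t + 1) ω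
      = X.weight w t ω * w ((X.path ω).act (t + 1)) ((X.path ω).obs (t + 1)) := by
  rw [weight, Finset.prod_Icc_succ_top (by omega), weight]

lemma measurable_act_obs {β : Type*} [MeasurableSpace β] (X : ElimTaS M h b c α δ Ω P)
    {f : A → O → β} (hf : ∀ a, Measurable (f a)) (t : ℕ) :
    Measurable[X.ℱ (t + 1)] fun ω => f ((X.path ω).act (t + 1)) ((X.path ω).obs (t + 1)) := by
  intro B hB
  have : (fun ω => f ((X.path ω).act (t + 1)) ((X.path ω).obs (t + 1))) ⁻¹' B
      = ⋃ a, {ω | (X.path ω).act (t + 1) = a} ∩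
          (fun ω => (X.path ω).obs (t + 1)) ⁻¹' (f a ⁻¹' B) := by
    ext ω
    simp
  rw [this]
  exact MeasurableSet.iUnion fun a =>
    (X.ℱ.mono (Nat.le_succ t) _ (X.act_meas t a)).inter (X.obs_meas t (hf a hB))

lemma measurable_weight (X : ElimTaS M h b c α δ Ω P) {w : A → O → ℝ≥0∞}
    (hw : ∀ a, Measurable (w a)) (t : ℕ) : Measurable[X.ℱ t] (X.weight w t) := by
  induction t with
  | zero =>
    simp_rw [funext (X.weight_zero w)]
    exact measurable_const
  | succ t ih =>
    simp_rw [funext (X.weight_succ w t)]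
    exact (ih.mono (X.ℱ.mono (Nat.le_succ t)) le_rfl).mul (X.measurable_act_obs hw t)

/-- This is the supermartingale property. The event is split by the next action, which the past
determines, so that the new factor integrates separately. -/
lemma setLIntegral_weight_succ_le [IsProbabilityMeasure P] (X : ElimTaS M h b c α δ Ω P)
    {w : A → O → ℝ≥0∞} (hw : ∀ a, Measurable (w a)) (hle : ∀ a, ∫⁻ o, w a o ∂M.law a h ≤ 1)
    (t : ℕ) {S : Set Ω} (hS : MeasurableSet[X.ℱ t] S) :
    ∫⁻ ω in S, X.weight w (t + 1) ω ∂P ≤ ∫⁻ ω in S, X.weight w t ω ∂P := by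
  have hU : S = ⋃ a ∈ (Finset.univ : Finset A), S ∩ {ω | (X.path ω).act (t + 1) = a} := by
    ext ω; simp
  have hm : ∀ a, MeasurableSet[X.ℱ t] (S ∩ {ω | (X.path ω).act (t + 1) = a}) :=
    fun a => hS.inter (X.act_meas t a)
  have hsplit : ∀ F : Ω → ℝ≥0∞, ∫⁻ ω in S, F ω ∂P
      = ∑ a, ∫⁻ ω in S ∩ {ω | (X.path ω).act (t + 1) = a}, F ω ∂P := fun F => by
    conv_lhs => rw [hU]
    refine lintegral_biUnion_finset ?_ (fun a _ => X.ℱ.le t _ (hm a)) F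
    intro a _ a' _ hne
    refine Set.disjoint_left.2 fun ω h1 h2 => hne ?_
    exact h1.2.symm.trans h2.2
  rw [hsplit, hsplit]
  refine Finset.sum_le_sum fun a _ => ?_
  calc _ = ∫⁻ ω in S ∩ {ω | (X.path ω).act (t + 1) = a},
        X.weight w t ω * w a ((X.path ω).obs (t + 1)) ∂P := by
        refine setLIntegral_congr_fun (X.ℱ.le t _ (hm a)) fun ω hω => ?_
        simp only [X.weight_succ w t ω, show (X.path ω).act (t + 1) = a from hω.2]
    _ = (∫⁻ ω in S ∩ {ω | (X.path ω).act (t + 1) = a}, X.weight w t ω ∂P)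
          * ∫⁻ o, w a o ∂M.law a h :=
        X.setLIntegral_mul_obs t a (hm a) (fun ω hω => hω.2) (hw a) (X.measurable_weight hw t)
    _ ≤ _ := mul_le_of_le_one_right' (hle a)

lemma lintegral_weight_le_one [IsProbabilityMeasure P] (X : ElimTaS M h b c α δ Ω P)
    {w : A → O → ℝ≥0∞} (hw : ∀ a, Measurable (w a)) (hle : ∀ a, ∫⁻ o, w a o ∂M.law a h ≤ 1)
    (t : ℕ) : ∫⁻ ω, X.weight w t ω ∂P ≤ 1 := by
  induction t with
  | zero => simp [weight_zero]
  | succ t ih =>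
    have := X.setLIntegral_weight_succ_le hw hle t (S := Set.univ) MeasurableSet.univ
    simp only [Measure.restrict_univ] at this
    exact this.trans ih

/-- Ville's maximal inequality for the weight process. -/
lemma mul_measure_exists_weight_ge_le [IsProbabilityMeasure P] (X : ElimTaS M h b c α δ Ω P)
    {w : A → O → ℝ≥0∞} (hw : ∀ a, Measurable (w a)) (hle : ∀ a, ∫⁻ o, w a o ∂M.law a h ≤ 1)
    (r : ℝ≥0∞) : r * P {ω | ∃ t, r ≤ X.weight w t ω} ≤ 1 := by
  let E : ℕ → Set Ω := fun t => {ω | ∃ s ≤ t, r ≤ X.weight w s ω}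
  have hE : ∀ t, MeasurableSet[X.ℱ t] (E t) := fun t => by
    have : E t = ⋃ s, ⋃ (_ : s ≤ t), {ω | r ≤ X.weight w s ω} := by ext ω; simp [E]
    rw [this]
    refine MeasurableSet.iUnion fun s => MeasurableSet.iUnion fun hs => ?_
    exact X.ℱ.mono hs _ (measurableSet_le measurable_const (X.measurable_weight hw s))
  -- The process is stopped when it reaches `r`: the surviving mass plus `r` times the probability
  -- of having crossed never exceeds its initial value.
  have key : ∀ t, ∫⁻ ω in (E t)ᶜ, X.weight w t ω ∂P + r * P (E t) ≤ 1 := by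
    intro t
    induction t with
    | zero =>
      have h0 : r * P (E 0) ≤ ∫⁻ ω in E 0, X.weight w 0 ω ∂P := by
        rw [← setLIntegral_const]
        refine setLIntegral_mono ((X.measurable_weight hw 0).mono (X.ℱ.le 0) le_rfl)
          fun ω hω => ?_
        obtain ⟨s, hs, h⟩ := hω
        rwa [Nat.le_zero.1 hs] at h
      calc _ ≤ ∫⁻ ω in (E 0)ᶜ, X.weight w 0 ω ∂P + ∫⁻ ω in E 0, X.weight w 0 ω ∂P := by gcongr
        _ = ∫⁻ ω, X.weight w 0 ω ∂P := by
            rw [add_comm, lintegral_add_compl _ (X.ℱ.le 0 _ (hE 0))]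
        _ ≤ 1 := X.lintegral_weight_le_one hw hle 0
    | succ t ih =>
      have hsub : E t ⊆ E (t + 1) := fun ω ⟨s, hs, h⟩ => ⟨s, hs.trans (Nat.le_succ t), h⟩
      have hmt := X.ℱ.le t _ (hE t)
      have hmt' := X.ℱ.le _ _ (hE (t + 1))
      have hWm := (X.measurable_weight hw (t + 1)).mono (X.ℱ.le _) le_rfl
      -- First passage at time `t + 1`, so the current weight is at least `r` on `D`.
      let D := E (t + 1) \ E t
      have hD : MeasurableSet D := hmt'.diff hmt
      have h1 : r * P D ≤ ∫⁻ ω in D, X.weight w (t + 1) ω ∂P := by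
        rw [← setLIntegral_const]
        refine setLIntegral_mono hWm fun ω hω => ?_
        obtain ⟨⟨s, hs, h⟩, hn⟩ := hω
        rcases Nat.lt_or_ge s (t + 1) with h' | h'
        · exact (hn ⟨s, Nat.lt_succ_iff.1 h', h⟩).elim
        · rwa [le_antisymm hs h'] at h
      have h2 : P (E (t + 1)) = P D + P (E t) := by
        rw [add_comm (P D), measure_add_sdiff hmt.nullMeasurableSet,
            Set.union_eq_self_of_subset_left hsub]
      have h3 : (E t)ᶜ = (E (t + 1))ᶜ ∪ D := by
        ext ω
        simp only [D, Set.mem_compl_iff, Set.mem_union, Set.mem_sdiff]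
        have := @hsub ω
        tauto
      have h4 : ∫⁻ ω in (E t)ᶜ, X.weight w (t + 1) ω ∂P
          = ∫⁻ ω in (E (t + 1))ᶜ, X.weight w (t + 1) ω ∂P
            + ∫⁻ ω in D, X.weight w (t + 1) ω ∂P := by
        rw [h3]
        refine lintegral_union hD (Set.disjoint_left.2 fun ω hω hω' => hω hω'.1)
      calc _ = ∫⁻ ω in (E (t + 1))ᶜ, X.weight w (t + 1) ω ∂P + r * P D + r * P (E t) := by
            rw [h2, mul_add, add_assoc]
        _ ≤ ∫⁻ ω in (E t)ᶜ, X.weight w (t + 1) ω ∂P + r * P (E t) := by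
            rw [h4]; gcongr
        _ ≤ ∫⁻ ω in (E t)ᶜ, X.weight w t ω ∂P + r * P (E t) := by
            exact add_le_add_left (X.setLIntegral_weight_succ_le hw hle t (hE t).compl) _
        _ ≤ 1 := ih
  have hUn : {ω | ∃ t, r ≤ X.weight w t ω} = ⋃ t, E t := by
    ext ω
    simp only [Set.mem_ofPred_eq, Set.mem_iUnion, E]
    exact ⟨fun ⟨t, h⟩ => ⟨t, t, le_rfl, h⟩, fun ⟨_, s, _, h⟩ => ⟨s, h⟩⟩
  have hmono : Monotone E := fun s t hst ω ⟨k, hk, h⟩ => ⟨k, hk.trans hst, h⟩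
  rw [hUn, hmono.measure_iUnion, ENNReal.mul_iSup]
  exact iSup_le fun t => le_add_self.trans (key t)

end ElimTaS

/-! ### Fluctuations of the log-likelihood ratio -/

/-- Deviation bound `K √(t log (1 + t))` with `K = v / 2 + 3`. -/
noncomputable def deviationRadius (v : ℝ) (t : ℝ) : ℝ :=
  (v / 2 + 3) * √(t * Real.log (1 + t))

namespace SamplePath

variable {H A O : Type*} [MeasurableSpace O]

lemma llr_eq_sum (M : SensingModel H A O) (x : SamplePath H A O) (t : ℕ) (h g : H) :
    x.llr M t h g = ∑ k ∈ Finset.Icc 1 t, M.logRatio (x.act k) h g (x.obs k) := by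
  simp [llr, logLik, SensingModel.logRatio]

open Classical in
/-- The number of rounds up to `t` whose action distinguishes `h` from `g`. -/
noncomputable def informative (M : SensingModel H A O) (x : SamplePath H A O) (t : ℕ) (h g : H) :
    ℝ :=
  ∑ k ∈ Finset.Icc 1 t, if M.d (x.act k) h g = 0 then 0 else 1

/-- The accumulated divergence of `h` from `g` over the first `t` rounds. -/
noncomputable def divergence (M : SensingModel H A O) (x : SamplePath H A O) (t : ℕ) (h g : H) :
    ℝ :=
  ∑ k ∈ Finset.Icc 1 t, M.d (x.act k) h g

end SamplePath

namespace ElimTaS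

variable {H A O : Type*} [MeasurableSpace O] [Fintype H] [Fintype A]
  {M : SensingModel H A O} {h : H} {b c α δ : ℝ}
  {Ω : Type*} [mΩ : MeasurableSpace Ω] {P : Measure Ω}

lemma weight_exp (X : ElimTaS M h b c α δ Ω P) (f : A → O → ℝ) (t : ℕ) (ω : Ω) :
    X.weight (fun a o => ENNReal.ofReal (Real.exp (f a o))) t ω
      = ENNReal.ofReal (Real.exp
          (∑ k ∈ Finset.Icc 1 t, f ((X.path ω).act k) ((X.path ω).obs k))) := by
  rw [weight, Real.exp_sum, ENNReal.ofReal_prod_of_nonneg fun _ _ => (Real.exp_pos _).le]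

open Classical in
/-- The surplus of informative rounds over the log-likelihood ratio is bounded, uniformly in time,
by a random variable of bounded expectation. -/
lemma exists_surplus_bound [IsProbabilityMeasure P] (X : ElimTaS M h b c α δ Ω P)
    (hfin : M.FiniteDivergence) {v : ℝ≥0} (hv : M.SubGaussianIncrements h v) {g : H} (hg : g ≠ h)
    {κ l : ℝ} (hκ : ∀ a, M.d a h g ≠ 0 → κ - l * M.d a h g + v * l ^ 2 / 2 ≤ 0) :
    ∃ Y : Ω → ℝ≥0∞, Measurable Y ∧
      ∫⁻ ω, Y ω ∂P ≤ ∑' n : ℕ, ENNReal.ofReal (Real.exp (-(n : ℝ))) ∧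
      ∀ ω t, ENNReal.ofReal
        (κ * (X.path ω).informative M t h g - l * (X.path ω).llr M t h g) ≤ Y ω := by
  -- Under an informative action the drift of `l * logRatio` pays for `κ`, by `hκ`; under an
  -- uninformative one the factor is almost surely `1`. The weight is therefore a supermartingale.
  let f : A → O → ℝ := fun a o =>
    κ * (if M.d a h g = 0 then 0 else 1) - l * M.logRatio a h g o
  let w : A → O → ℝ≥0∞ := fun a o => ENNReal.ofReal (Real.exp (f a o))
  have hw : ∀ a, Measurable (w a) := fun a =>
    ((measurable_const.sub ((M.measurable_logRatio a h g).const_mul l)).exp).ennreal_ofReal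
  have hle : ∀ a, ∫⁻ o, w a o ∂M.law a h ≤ 1 := fun a => by
    by_cases hd : M.d a h g = 0
    · have := M.lintegral_exp_logRatio_of_d_eq_zero hfin a hd (-l)
      simp only [w, f, hd, if_true, mul_zero, zero_sub]
      simp only [neg_mul] at this
      exact this.le
    · calc ∫⁻ o, w a o ∂M.law a h
          = ∫⁻ o, ENNReal.ofReal (Real.exp κ) *
              ENNReal.ofReal (Real.exp (-l * M.logRatio a h g o)) ∂M.law a h := by
            refine lintegral_congr fun o => ?_
            rw [← ENNReal.ofReal_mul (Real.exp_pos _).le, ← Real.exp_add]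
            simp only [w, f, hd, if_false, mul_one, neg_mul, sub_eq_add_neg]
        _ ≤ ENNReal.ofReal (Real.exp κ) *
              ENNReal.ofReal (Real.exp (-l * M.d a h g + v * (-l) ^ 2 / 2)) := by
            rw [lintegral_const_mul' _ _ ENNReal.ofReal_ne_top]
            gcongr
            exact M.lintegral_exp_logRatio_le hfin hv a hg (-l)
        _ ≤ 1 := by
            rw [← ENNReal.ofReal_mul (Real.exp_pos _).le, ← Real.exp_add,
              ENNReal.ofReal_le_one, Real.exp_le_one_iff]
            have := hκ a hd
            rw [neg_sq]
            linarith
  have hweight : ∀ ω t, X.weight w t ω = ENNReal.ofReal (Real.exp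
      (κ * (X.path ω).informative M t h g - l * (X.path ω).llr M t h g)) := fun ω t => by
    rw [X.weight_exp f t ω, SamplePath.llr_eq_sum, SamplePath.informative, Finset.mul_sum,
      Finset.mul_sum, ← Finset.sum_sub_distrib]
  let E : ℕ → Set Ω := fun n => {ω | ∃ t, ENNReal.ofReal (Real.exp n) ≤ X.weight w t ω}
  have hE : ∀ n, MeasurableSet (E n) := fun n => by
    have : E n = ⋃ t, {ω | ENNReal.ofReal (Real.exp n) ≤ X.weight w t ω} := by ext; simp [E]
    rw [this]
    exact MeasurableSet.iUnion fun t => measurableSet_le measurable_const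
      ((X.measurable_weight hw t).mono (X.ℱ.le _) le_rfl)
  -- `Y` counts the integers `n` for which the weight ever reaches `exp n`. It dominates the
  -- exponent at every time, and Ville's inequality bounds the probability of level `n` by `exp
  -- (-n)`.
  refine ⟨fun ω => ∑' n, (E n).indicator 1 ω,
    Measurable.tsum fun n => measurable_one.indicator (hE n), ?_, fun ω t => ?_⟩
  · rw [lintegral_tsum fun n => (measurable_one.indicator (hE n)).aemeasurable]
    refine ENNReal.tsum_le_tsum fun n => ?_
    rw [lintegral_indicator_one (hE n), Real.exp_neg, ENNReal.ofReal_inv_of_pos (Real.exp_pos _),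
      ← one_div]
    have hpos : ENNReal.ofReal (Real.exp n) ≠ 0 := by simp [Real.exp_pos]
    rw [ENNReal.le_div_iff_mul_le (Or.inl hpos) (Or.inl ENNReal.ofReal_ne_top), mul_comm]
    exact X.mul_measure_exists_weight_ge_le hw hle _
  · set z := κ * (X.path ω).informative M t h g - l * (X.path ω).llr M t h g with hz
    rcases le_or_gt z 0 with hz0 | hz0
    · simp [ENNReal.ofReal_of_nonpos hz0]
    calc ENNReal.ofReal z ≤ ENNReal.ofReal ((⌊z⌋₊ + 1 : ℕ) : ℝ) := by
          gcongr
          push_cast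
          exact (Nat.lt_floor_add_one z).le
      _ = ∑ n ∈ Finset.range (⌊z⌋₊ + 1), (E n).indicator 1 ω := by
          rw [ENNReal.ofReal_natCast, Finset.sum_congr rfl (g := fun _ => (1 : ℝ≥0∞))]
          · simp
          · intro n hn
            have hnz : (n : ℝ) ≤ z :=
              (Nat.le_floor_iff hz0.le).1 (Nat.lt_succ_iff.1 (Finset.mem_range.1 hn))
            have : ω ∈ E n := ⟨t, by rw [hweight]; gcongr⟩
            simp [this]
      _ ≤ _ := ENNReal.sum_le_tsum _

/-- The shortfall of the log-likelihood ratio with respect to the accumulated divergence exceeds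
the deviation radius at most by a random variable of bounded expectation. -/
lemma exists_shortfall_bound [IsProbabilityMeasure P] (X : ElimTaS M h b c α δ Ω P)
    (hfin : M.FiniteDivergence) {v : ℝ≥0} (hv : M.SubGaussianIncrements h v) {g : H}
    (hg : g ≠ h) :
    ∃ R : Ω → ℝ≥0∞, Measurable R ∧
      ∫⁻ ω, R ω ∂P ≤ ∑' n : ℕ, ENNReal.ofReal (2 * (1 / ((n : ℝ) + 1) ^ 2)) ∧
      ∀ ω t, ENNReal.ofReal
        ((X.path ω).divergence M t h g - (X.path ω).llr M t h g - deviationRadius v t)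
          ≤ R ω := by
  -- This tuning makes `t * θ t ^ 2` and `θ t * √(t log (1 + t))` both equal to `log (1 + t)`. The
  -- exponent varies with the horizon `t`, so each weight is used only at its own time and the
  -- bounds are summed over `t`.
  let θ : ℕ → ℝ := fun t => √(Real.log (1 + t) / t)
  let f : ℕ → A → O → ℝ := fun t a o =>
    θ t * (M.d a h g - M.logRatio a h g o) - v * θ t ^ 2 / 2
  let w : ℕ → A → O → ℝ≥0∞ := fun t a o => ENNReal.ofReal (Real.exp (f t a o))
  have hw : ∀ t a, Measurable (w t a) := fun t a =>
    ((((measurable_const.sub (M.measurable_logRatio a h g)).const_mul _).sub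
      measurable_const).exp).ennreal_ofReal
  have hle : ∀ t a, ∫⁻ o, w t a o ∂M.law a h ≤ 1 := fun t a => by
    calc ∫⁻ o, w t a o ∂M.law a h
        = ∫⁻ o, ENNReal.ofReal (Real.exp (θ t * M.d a h g - v * θ t ^ 2 / 2)) *
            ENNReal.ofReal (Real.exp (-θ t * M.logRatio a h g o)) ∂M.law a h := by
          refine lintegral_congr fun o => ?_
          rw [← ENNReal.ofReal_mul (Real.exp_pos _).le, ← Real.exp_add]
          simp only [w, f]
          ring_nf
      _ ≤ ENNReal.ofReal (Real.exp (θ t * M.d a h g - v * θ t ^ 2 / 2)) *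
            ENNReal.ofReal (Real.exp (-θ t * M.d a h g + v * (-θ t) ^ 2 / 2)) := by
          rw [lintegral_const_mul' _ _ ENNReal.ofReal_ne_top]
          gcongr
          exact M.lintegral_exp_logRatio_le hfin hv a hg (-θ t)
      _ ≤ 1 := by
          rw [← ENNReal.ofReal_mul (Real.exp_pos _).le, ← Real.exp_add,
            ENNReal.ofReal_le_one, Real.exp_le_one_iff]
          exact (by ring : _ = (0 : ℝ)).le
  have hweight : ∀ ω t, X.weight (w t) t ω = ENNReal.ofReal (Real.exp
      (θ t * ((X.path ω).divergence M t h g - (X.path ω).llr M t h g)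
        - t * (v * θ t ^ 2 / 2))) := fun ω t => by
    rw [X.weight_exp (f t) t ω, SamplePath.llr_eq_sum, SamplePath.divergence,
      ← Finset.sum_sub_distrib, Finset.mul_sum]
    simp [f, Finset.sum_sub_distrib]
  let c' : ℕ → ℝ := fun t => if t = 0 then 0 else 2 * (1 / ((t : ℝ) + 1) ^ 2)
  have hpt : ∀ ω t, ENNReal.ofReal
      ((X.path ω).divergence M t h g - (X.path ω).llr M t h g - deviationRadius v t)
        ≤ ENNReal.ofReal (c' t) * X.weight (w t) t ω := fun ω t => by
    rcases Nat.eq_zero_or_pos t with rfl | ht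
    · simp [SamplePath.divergence, SamplePath.llr_eq_sum, deviationRadius]
    have ht' : (1 : ℝ) ≤ t := by exact_mod_cast ht
    have ht0 : (0 : ℝ) < t := by linarith
    set ℓ := Real.log (1 + t) with hℓ
    have hℓ2 : 1 / 2 ≤ ℓ := by
      have h1 : Real.log 2 ≤ ℓ := Real.log_le_log (by norm_num) (by linarith)
      have h2 := Real.log_two_gt_d9
      linarith
    have hθ : 0 < θ t := Real.sqrt_pos.2 (by positivity)
    have hθ2 : t * θ t ^ 2 = ℓ := by
      rw [Real.sq_sqrt (by positivity), mul_div_cancel₀ _ ht0.ne']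
    have hθφ : θ t * √(t * ℓ) = ℓ := by
      rw [← Real.sqrt_mul (by positivity), show ℓ / t * (t * ℓ) = ℓ ^ 2 by field_simp,
        Real.sqrt_sq (by linarith)]
    have hθi : (θ t)⁻¹ ≤ 2 * (1 + t) := by
      rw [← Real.sqrt_inv, inv_div]
      refine Real.sqrt_le_iff.2 ⟨by positivity, ?_⟩
      rw [div_le_iff₀ (by linarith)]
      nlinarith
    have hexp : Real.exp (-(3 * ℓ)) = 1 / (1 + (t : ℝ)) ^ 3 := by
      rw [Real.exp_neg, hℓ, show (3 : ℝ) * Real.log (1 + t) = Real.log (1 + t) * (3 : ℕ) by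
        push_cast; ring, Real.exp_mul, Real.exp_log (by positivity), Real.rpow_natCast, one_div]
    rw [hweight, ← ENNReal.ofReal_mul (by simp only [c']; positivity)]
    refine ENNReal.ofReal_le_ofReal ?_
    set D := (X.path ω).divergence M t h g - (X.path ω).llr M t h g
    -- From `z ≤ exp z`. The `v / 2` in the radius cancels the sub-Gaussian correction; the `3`
    -- leaves a factor `(1 + t)⁻³`, which remains summable after multiplication by `(θ t)⁻¹ ≤ 2 (1 +
    -- t)`.
    have h1 : D - deviationRadius v t ≤ (θ t)⁻¹ * Real.exp (θ t * (D - deviationRadius v t)) := by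
      rw [inv_mul_eq_div, le_div_iff₀ hθ]
      have := Real.add_one_le_exp (θ t * (D - deviationRadius v t))
      linarith
    have h2 : θ t * (D - deviationRadius v t)
        = (θ t * D - t * (v * θ t ^ 2 / 2)) + -(3 * ℓ) := by
      rw [deviationRadius, ← hℓ]
      linear_combination (v / 2 : ℝ) * hθ2 - (v / 2 + 3) * hθφ
    rw [h2, Real.exp_add, hexp] at h1
    refine h1.trans ?_
    have h3 : c' t = 2 * (1 + t) * (1 / (1 + (t : ℝ)) ^ 3) := by
      simp only [c', ht.ne', if_false]
      have : (1 + (t : ℝ)) ≠ 0 := by positivity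
      rw [add_comm (t : ℝ) 1]
      field_simp
    rw [h3, mul_comm (Real.exp _), ← mul_assoc]
    gcongr
  refine ⟨fun ω => ∑' t, ENNReal.ofReal (c' t) * X.weight (w t) t ω,
    Measurable.tsum fun t => (((X.measurable_weight (hw t) t).mono (X.ℱ.le _)
      le_rfl)).const_mul _, ?_, fun ω t => (hpt ω t).trans (ENNReal.le_tsum t)⟩
  rw [lintegral_tsum fun t => ((((X.measurable_weight (hw t) t).mono (X.ℱ.le _)
      le_rfl)).const_mul _).aemeasurable]
  refine ENNReal.tsum_le_tsum fun t => ?_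
  rw [lintegral_const_mul' _ _ ENNReal.ofReal_ne_top]
  refine (mul_le_of_le_one_right' (X.lintegral_weight_le_one (hw t) (hle t) t)).trans
    (ENNReal.ofReal_le_ofReal ?_)
  simp only [c']
  split_ifs
  · positivity
  · exact le_rfl

end ElimTaS

/-! ### Action counts, active sets and C-tracking -/

namespace SamplePath

variable {H A O : Type*}

lemma sum_act_eq [Fintype A] (x : SamplePath H A O) (f : A → ℝ) (t : ℕ) :
    ∑ k ∈ Finset.Icc 1 t, f (x.act k) = ∑ a, (x.count a t : ℝ) * f a := by
  classical
  rw [← Finset.sum_fiberwise (Finset.Icc 1 t) x.act]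
  refine Finset.sum_congr rfl fun a _ => ?_
  rw [Finset.sum_congr rfl (g := fun _ => f a) fun k hk => by rw [(Finset.mem_filter.1 hk).2],
    Finset.sum_const, nsmul_eq_mul, count]

open Classical in
lemma count_succ (x : SamplePath H A O) (a : A) (t : ℕ) :
    x.count a (t + 1) = x.count a t + if x.act (t + 1) = a then 1 else 0 := by
  have : Finset.Icc 1 (t + 1) = insert (t + 1) (Finset.Icc 1 t) := by
    ext k; simp only [Finset.mem_insert, Finset.mem_Icc]; omega
  rw [count, count, this, Finset.filter_insert]
  split_ifs
  · rw [Finset.card_insert_of_notMem (by simp)]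
  · simp

variable [MeasurableSpace O] [Fintype H]

lemma mem_active {M : SensingModel H A O} {b c α δ : ℝ} {x : SamplePath H A O} {t : ℕ} {i g : H} :
    g ∈ x.active M b c α δ t i ↔
      g ≠ i ∧ ∀ s, 1 ≤ s → s ≤ t → x.champ s = i → x.llr M s i g < elimThreshold b c α δ s := by
  simp [active]

lemma active_anti (M : SensingModel H A O) (b c α δ : ℝ) (x : SamplePath H A O) (i : H) :
    Antitone fun t => x.active M b c α δ t i := fun _ _ hst _ hg =>
  mem_active.2 ⟨(mem_active.1 hg).1, fun r h1 h2 => (mem_active.1 hg).2 r h1 (h2.trans hst)⟩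

lemma active_champ_nonempty {M : SensingModel H A O} {b c α δ : ℝ} {x : SamplePath H A O} {t : ℕ}
    (h1 : 1 ≤ t) (ht : (t : ℕ∞) < x.stopTime M b c α δ) :
    (x.active M b c α δ t (x.champ t)).Nonempty := by
  rw [Finset.nonempty_iff_ne_empty]
  exact fun h0 => absurd (iInf₂_le t ⟨h1, h0⟩) (not_le.2 ht)

end SamplePath

namespace ElimTaS

variable {H A O : Type*} [MeasurableSpace O] [Fintype H] [Fintype A]
  {M : SensingModel H A O} {h : H} {b c α δ : ℝ}
  {Ω : Type*} [mΩ : MeasurableSpace Ω] {P : Measure Ω}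

lemma target_mem (X : ElimTaS M h b c α δ Ω P) {ω : Ω} {s t : ℕ} (hst : s ≤ t)
    (ht : (t : ℕ∞) < X.τ ω) : X.target ω s ∈ stdSimplex ℝ A :=
  (X.target_oracle ω s ((Nat.cast_le.2 hst).trans_lt ht)).1

lemma sum_tracking_error (X : ElimTaS M h b c α δ Ω P) {ω : Ω} {t : ℕ} (ht : (t : ℕ∞) < X.τ ω) :
    ∑ a, (∑ s ∈ Finset.Icc 1 t, X.target ω s a - ((X.path ω).count a t : ℝ)) = 0 := by
  have h1 := (X.path ω).sum_act_eq (fun _ => 1) t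
  simp only [mul_one] at h1
  rw [Finset.sum_sub_distrib, Finset.sum_comm, ← h1, sub_eq_zero]
  exact Finset.sum_congr rfl fun s hs => (X.target_mem (Finset.mem_Icc.1 hs).2 ht).2

/-- Targets are nonnegative, so an error drops only when its action is selected, and then by at most
`1` from a nonnegative value. -/
lemma neg_one_le_tracking_error (X : ElimTaS M h b c α δ Ω P) {ω : Ω} {t : ℕ}
    (ht : (t : ℕ∞) < X.τ ω) (a : A) :
    -1 ≤ ∑ s ∈ Finset.Icc 1 t, X.target ω s a - ((X.path ω).count a t : ℝ) := by
  induction t with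
  | zero => simp [SamplePath.count]
  | succ t ih =>
    have ht' : (t : ℕ∞) < X.τ ω := lt_of_le_of_lt (Nat.cast_le.2 (Nat.le_succ t)) ht
    have h0 := (X.target_mem le_rfl ht).1 a
    have h1 := ih ht'
    rw [Finset.sum_Icc_succ_top (by omega), SamplePath.count_succ]
    split_ifs with hact
    · have hmax := X.tracking ω t ht'
      rw [hact] at hmax
      -- The selected action has the largest error, and the errors sum to zero.
      have h2 : 0 ≤ ∑ s ∈ Finset.Icc 1 t, X.target ω s a - ((X.path ω).count a t : ℝ) := by
        by_contra hneg
        have : Nonempty A := ⟨a⟩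
        have := Finset.sum_lt_sum_of_nonempty (s := (Finset.univ : Finset A))
          Finset.univ_nonempty fun a' _ => (hmax a').trans_lt (not_le.1 hneg)
        rw [X.sum_tracking_error ht'] at this
        simp at this
      push_cast
      linarith
    · push_cast
      linarith

/-- The errors sum to zero and each is at least `-1`, so none can exceed the number of the others.
-/
lemma tracking_error_le (X : ElimTaS M h b c α δ Ω P) {ω : Ω} {t : ℕ}
    (ht : (t : ℕ∞) < X.τ ω) (a : A) :
    ∑ s ∈ Finset.Icc 1 t, X.target ω s a - ((X.path ω).count a t : ℝ) ≤ Fintype.card A := by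
  classical
  have h0 := X.sum_tracking_error ht
  rw [← Finset.add_sum_erase _ _ (Finset.mem_univ a)] at h0
  have h1 : ∑ a' ∈ Finset.univ.erase a, (-1 : ℝ) ≤ _ :=
    Finset.sum_le_sum fun a' _ => X.neg_one_le_tracking_error ht a'
  rw [Finset.sum_const, Finset.card_erase_of_mem (Finset.mem_univ a), Finset.card_univ,
    nsmul_eq_mul] at h1
  have h2 : ((Fintype.card A - 1 : ℕ) : ℝ) ≤ Fintype.card A := by
    exact_mod_cast Nat.sub_le _ _
  linarith

/-- Tracking transfers any bounded nonnegative reward from the targets to the actions played, at a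
cost that does not grow with time. -/
lemma sum_target_mul_le (X : ElimTaS M h b c α δ Ω P) {ω : Ω} {t : ℕ}
    (ht : (t : ℕ∞) < X.τ ω) {q : A → ℝ} {B : ℝ} (hq : ∀ a, 0 ≤ q a) (hB : ∀ a, q a ≤ B) :
    ∑ s ∈ Finset.Icc 1 t, ∑ a, X.target ω s a * q a
      ≤ ∑ k ∈ Finset.Icc 1 t, q ((X.path ω).act k) + (Fintype.card A : ℝ) ^ 2 * B := by
  rw [SamplePath.sum_act_eq, Finset.sum_comm, ← sub_le_iff_le_add', ← Finset.sum_sub_distrib]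
  calc _ = ∑ a, (∑ s ∈ Finset.Icc 1 t, X.target ω s a - ((X.path ω).count a t : ℝ)) * q a := by
        refine Finset.sum_congr rfl fun a _ => ?_
        rw [sub_mul, Finset.sum_mul]
    _ ≤ ∑ _a : A, (Fintype.card A : ℝ) * B := by
        refine Finset.sum_le_sum fun a _ => ?_
        calc _ ≤ (Fintype.card A : ℝ) * q a :=
              mul_le_mul_of_nonneg_right (X.tracking_error_le ht a) (hq a)
          _ ≤ _ := by gcongr; exact hB a
    _ = _ := by
        rw [Finset.sum_const, Finset.card_univ, nsmul_eq_mul]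
        ring

/-- Rounds with a large targeted information force informative actions. -/
lemma mul_card_le (X : ElimTaS M h b c α δ Ω P) {ω : Ω} {t : ℕ}
    (ht : (t : ℕ∞) < X.τ ω) {q : A → ℝ} {B ε : ℝ} (hq : ∀ a, 0 ≤ q a) (hB : ∀ a, q a ≤ B)
    {T : Finset ℕ} (hT : T ⊆ Finset.Icc 1 t) (hε : ∀ s ∈ T, ε ≤ ∑ a, X.target ω s a * q a) :
    ε * T.card ≤ ∑ k ∈ Finset.Icc 1 t, q ((X.path ω).act k) + (Fintype.card A : ℝ) ^ 2 * B := by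
  refine le_trans ?_ (X.sum_target_mul_le ht hq hB)
  calc ε * T.card = ∑ s ∈ T, ε := by rw [Finset.sum_const, nsmul_eq_mul, mul_comm]
    _ ≤ ∑ s ∈ T, ∑ a, X.target ω s a * q a := Finset.sum_le_sum hε
    _ ≤ _ := Finset.sum_le_sum_of_subset_of_nonneg hT fun s hs _ =>
        Finset.sum_nonneg fun a _ =>
          mul_nonneg ((X.target_mem (Finset.mem_Icc.1 hs).2 ht).1 a) (hq a)

lemma llr_nonpos_of_champ (X : ElimTaS M h b c α δ Ω P) {ω : Ω} {s : ℕ} {i : H}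
    (hi : (X.path ω).champ s = i) (g : H) : (X.path ω).llr M s g i ≤ 0 := by
  have := X.champ_max ω s g
  rw [hi] at this
  rw [SamplePath.llr]
  linarith

/-! ### Rounds under a wrong champion -/

/-- Number of rounds in which a wrong champion, for which the truth is still active, reigns. -/
lemma card_wrong_champ_active_le [DecidableEq H] (X : ElimTaS M h b c α δ Ω P)
    (hfin : M.FiniteDivergence)
    {ω : Ω} {t : ℕ} (ht : (t : ℕ∞) < X.τ ω) {i : H} (hi : i ≠ h) {κ l y ε B : ℝ} (hκ : 0 < κ)
    (hl : 0 < l) (hy0 : 0 ≤ y) (hε : 0 < ε) (hB0 : 0 < B) (hB : ∀ a i g, M.d a i g ≤ B)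
    (hεo : ∀ (i : H) (S : Finset H) (w : A → ℝ), i ∉ S → M.IsOracle i S w → ∀ g ∈ S,
      ε ≤ ∑ a, w a * M.d a i g)
    (hy : ∀ g ≠ h, ∀ t,
      κ * (X.path ω).informative M t h g - l * (X.path ω).llr M t h g ≤ y) :
    (((Finset.Icc 1 t).filter fun s => (X.path ω).champ s = i ∧
      h ∈ (X.path ω).active M b c α δ s i).card : ℝ)
        ≤ B / ε * (y / κ + (Fintype.card A : ℝ) ^ 2) := by
  set T := (Finset.Icc 1 t).filter fun s => (X.path ω).champ s = i ∧
      h ∈ (X.path ω).active M b c α δ s i with hT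
  rcases T.eq_empty_or_nonempty with h0 | hne
  · rw [h0]
    simp only [Finset.card_empty, Nat.cast_zero]
    positivity
  have hm := T.max'_mem hne
  -- Everything is evaluated at the last round of `T`, where `i` is champion and hence the ratio of
  -- the truth against `i` is nonpositive.
  set s₀ := T.max' hne
  obtain ⟨hs1, hs2⟩ := Finset.mem_Icc.1 (Finset.mem_filter.1 hm).1
  have hch := (Finset.mem_filter.1 hm).2.1
  have hs0 : (s₀ : ℕ∞) < X.τ ω := lt_of_le_of_lt (Nat.cast_le.2 hs2) ht
  have hsub : T ⊆ Finset.Icc 1 s₀ := fun s hs =>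
    Finset.mem_Icc.2 ⟨(Finset.mem_Icc.1 (Finset.mem_filter.1 hs).1).1, T.le_max' s hs⟩
  -- The divergence from `i` to the truth is replaced by an indicator, since it vanishes together
  -- with the one in the opposite direction.
  let q : A → ℝ := fun a => if M.d a h i = 0 then 0 else 1
  have hq0 : ∀ a, 0 ≤ q a := fun a => by simp only [q]; split_ifs <;> norm_num
  have hq1 : ∀ a, q a ≤ 1 := fun a => by simp only [q]; split_ifs <;> norm_num
  have hdq : ∀ a, M.d a i h ≤ B * q a := fun a => by
    simp only [q]
    split_ifs with hd
    · rw [M.d_eq_zero_iff hfin] at hd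
      rw [((M.d_eq_zero_iff hfin a i h).2 hd.symm), mul_zero]
    · rw [mul_one]; exact hB a i h
  have hcard := X.mul_card_le hs0 (q := q) (ε := ε / B) hq0 hq1 hsub fun s hs => by
    obtain ⟨hs', hc', hact⟩ := Finset.mem_filter.1 hs
    have hsτ : (s : ℕ∞) < X.τ ω :=
      lt_of_le_of_lt (Nat.cast_le.2 (Finset.mem_Icc.1 hs').2) ht
    have ho := X.target_oracle ω s hsτ
    rw [hc'] at ho
    have h1 := hεo i _ _ (fun hmem => (SamplePath.mem_active.1 hmem).1 rfl) ho h hact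
    rw [div_le_iff₀ hB0, Finset.sum_mul]
    refine h1.trans (Finset.sum_le_sum fun a _ => ?_)
    rw [mul_assoc, mul_comm (q a)]
    exact mul_le_mul_of_nonneg_left (hdq a) (ho.1.1 a)
  have hinf : (X.path ω).informative M s₀ h i ≤ y / κ := by
    rw [le_div_iff₀ hκ, mul_comm]
    have h1 := hy i hi s₀
    have h2 := X.llr_nonpos_of_champ hch h
    nlinarith
  have : ε / B * T.card ≤ y / κ + (Fintype.card A : ℝ) ^ 2 := by
    rw [mul_one] at hcard
    exact hcard.trans (by gcongr; exact hinf)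
  calc (T.card : ℝ) = B / ε * (ε / B * T.card) := by field_simp
    _ ≤ _ := by gcongr

/-- Number of rounds in which a wrong champion that has eliminated the truth reigns. -/
lemma card_wrong_champ_eliminated_le [DecidableEq H] (X : ElimTaS M h b c α δ Ω P)
    (hfin : M.FiniteDivergence)
    (hb : 0 ≤ b) (hc : 0 ≤ c)
    {ω : Ω} {t : ℕ} (ht : (t : ℕ∞) < X.τ ω) {i : H} (hi : i ≠ h) {κ l y ε B : ℝ} (hκ : 0 < κ)
    (hl : 0 < l) (hy0 : 0 ≤ y) (hε : 0 < ε) (hB0 : 0 < B) (hB : ∀ a i g, M.d a i g ≤ B)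
    (hεo : ∀ (i : H) (S : Finset H) (w : A → ℝ), i ∉ S → M.IsOracle i S w → ∀ g ∈ S,
      ε ≤ ∑ a, w a * M.d a i g)
    (hy : ∀ g ≠ h, ∀ t,
      κ * (X.path ω).informative M t h g - l * (X.path ω).llr M t h g ≤ y) :
    (((Finset.Icc 1 t).filter fun s => (X.path ω).champ s = i ∧
      h ∉ (X.path ω).active M b c α δ s i).card : ℝ)
        ≤ B / ε * ((3 * y + l * b * Real.log (1 + t) + l * c) / κ
            + 2 * (Fintype.card A : ℝ) ^ 2) := by
  set T := (Finset.Icc 1 t).filter fun s => (X.path ω).champ s = i ∧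
      h ∉ (X.path ω).active M b c α δ s i with hT
  have hlog0 : 0 ≤ Real.log (1 + t) :=
    Real.log_nonneg (by linarith [(Nat.cast_nonneg t : (0 : ℝ) ≤ t)])
  rcases T.eq_empty_or_nonempty with h0 | hne
  · rw [h0]
    simp only [Finset.card_empty, Nat.cast_zero]
    positivity
  have hm := T.max'_mem hne
  set s₀ := T.max' hne
  obtain ⟨hs1, hs2⟩ := Finset.mem_Icc.1 (Finset.mem_filter.1 hm).1
  obtain ⟨hch, helim⟩ := (Finset.mem_filter.1 hm).2
  have hs0 : (s₀ : ℕ∞) < X.τ ω := lt_of_le_of_lt (Nat.cast_le.2 hs2) ht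
  have hsub : T ⊆ Finset.Icc 1 s₀ := fun s hs =>
    Finset.mem_Icc.2 ⟨(Finset.mem_Icc.1 (Finset.mem_filter.1 hs).1).1, T.le_max' s hs⟩
  -- The run has not stopped, so `i` still has an active opponent; it differs from the eliminated
  -- truth and was active in all rounds of `T`.
  obtain ⟨g, hg⟩ := SamplePath.active_champ_nonempty hs1 hs0
  rw [hch] at hg
  have hgh : g ≠ h := fun e => helim (e ▸ hg)
  -- If the truth agrees in law with both `i` and `g` under an action, then `i` and `g` agree as
  -- well.
  let q : A → ℝ := fun a =>
    (if M.d a h i = 0 then 0 else 1) + (if M.d a h g = 0 then 0 else 1)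
  have hq0 : ∀ a, 0 ≤ q a := fun a => by simp only [q]; split_ifs <;> norm_num
  have hq1 : ∀ a, q a ≤ 2 := fun a => by simp only [q]; split_ifs <;> norm_num
  have hdq : ∀ a, M.d a i g ≤ B * q a := fun a => by
    by_cases h1 : M.d a h i = 0
    · by_cases h2 : M.d a h g = 0
      · simp only [q, h1, h2, if_true]
        rw [M.d_eq_zero_iff hfin] at h1 h2
        rw [(M.d_eq_zero_iff hfin a i g).2 (h1.symm.trans h2)]
        simp
      · simp only [q, h1, h2, if_true, if_false]
        linarith [hB a i g]
    · refine (hB a i g).trans (le_mul_of_one_le_right hB0.le ?_)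
      simp only [q, h1, if_false]
      split_ifs <;> norm_num
  have hcard := X.mul_card_le hs0 (q := q) (ε := ε / B) hq0 hq1 hsub fun s hs => by
    obtain ⟨hs', hc', hact⟩ := Finset.mem_filter.1 hs
    have hsτ : (s : ℕ∞) < X.τ ω :=
      lt_of_le_of_lt (Nat.cast_le.2 (Finset.mem_Icc.1 hs').2) ht
    have ho := X.target_oracle ω s hsτ
    rw [hc'] at ho
    have h1 := hεo i _ _ (fun hmem => (SamplePath.mem_active.1 hmem).1 rfl) ho g
      ((X.path ω).active_anti M b c α δ i (T.le_max' s hs) hg)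
    rw [div_le_iff₀ hB0, Finset.sum_mul]
    refine h1.trans (Finset.sum_le_sum fun a _ => ?_)
    rw [mul_assoc, mul_comm (q a)]
    exact mul_le_mul_of_nonneg_left (hdq a) (ho.1.1 a)
  have hllr : (X.path ω).llr M s₀ h i ≤ 0 := X.llr_nonpos_of_champ hch h
  have hinf : (X.path ω).informative M s₀ h i ≤ y / κ := by
    rw [le_div_iff₀ hκ, mul_comm]
    have h1 := hy i hi s₀
    nlinarith
  -- the elimination of the truth bounds the confidence level by the surplus
  have hx : l * (α * Real.log (1 / δ)) ≤ y := by
    rw [SamplePath.mem_active] at helim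
    push Not at helim
    obtain ⟨s, h1, -, hcs, hz⟩ := helim hi.symm
    have h2 := hy i hi s
    have h3 : 0 ≤ (X.path ω).informative M s h i :=
      Finset.sum_nonneg fun k _ => by split_ifs <;> norm_num
    have h4 : (X.path ω).llr M s h i = -(X.path ω).llr M s i h := by
      simp only [SamplePath.llr]; ring
    have h5 : 0 ≤ b * Real.log s := mul_nonneg hb (Real.log_natCast_nonneg s)
    have h6 : α * Real.log (1 / δ) ≤ (X.path ω).llr M s i h := by
      rw [elimThreshold] at hz
      linarith
    rw [h4] at h2
    have := mul_nonneg hκ.le h3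
    nlinarith
  -- The confidence level has just been absorbed into `y`, so the bound on the threshold contains no
  -- `α * log (1 / δ)`.
  have hβ : l * elimThreshold b c α δ s₀ ≤ y + l * b * Real.log (1 + t) + l * c := by
    have h1 : Real.log s₀ ≤ Real.log (1 + t) := by
      refine Real.log_le_log (by exact_mod_cast hs1) ?_
      have : (s₀ : ℝ) ≤ t := by exact_mod_cast hs2
      linarith
    have h2 : l * b * Real.log s₀ ≤ l * b * Real.log (1 + t) := by gcongr
    rw [elimThreshold]
    linarith
  have hinf' : (X.path ω).informative M s₀ h g
      ≤ (2 * y + l * b * Real.log (1 + t) + l * c) / κ := by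
    rw [le_div_iff₀ hκ, mul_comm]
    have h1 := hy g hgh s₀
    have h2 := (SamplePath.mem_active.1 hg).2 s₀ hs1 le_rfl hch
    have h3 : (X.path ω).llr M s₀ h g
        = (X.path ω).llr M s₀ h i + (X.path ω).llr M s₀ i g := by
      simp only [SamplePath.llr]; ring
    have h4 : l * (X.path ω).llr M s₀ h g ≤ l * elimThreshold b c α δ s₀ := by
      gcongr
      linarith
    linarith
  have hsum : ε / B * T.card ≤ (3 * y + l * b * Real.log (1 + t) + l * c) / κ
      + 2 * (Fintype.card A : ℝ) ^ 2 := by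
    refine hcard.trans ?_
    have : ∑ k ∈ Finset.Icc 1 s₀, q ((X.path ω).act k)
        = (X.path ω).informative M s₀ h i + (X.path ω).informative M s₀ h g :=
      Finset.sum_add_distrib
    rw [this, mul_comm _ (2 : ℝ)]
    gcongr
    calc _ ≤ y / κ + (2 * y + l * b * Real.log (1 + t) + l * c) / κ := add_le_add hinf hinf'
      _ = _ := by ring
  calc (T.card : ℝ) = B / ε * (ε / B * T.card) := by field_simp
    _ ≤ _ := by gcongr

end ElimTaS

/-! ### Solving the implicit inequality for the duration -/

lemma log_one_add_le_sqrt {t : ℝ} (ht : 0 ≤ t) :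
    Real.log (1 + t) ≤ √(t * Real.log (1 + t)) := by
  have h0 : 0 ≤ Real.log (1 + t) := Real.log_nonneg (by linarith)
  have h1 : Real.log (1 + t) ≤ t := by
    have := Real.log_le_sub_one_of_pos (show 0 < 1 + t by linarith)
    linarith
  exact Real.le_sqrt_of_sq_le (by nlinarith)

/-- Solving the implicit inequality `t ≤ x / D + K √(t log (1 + t)) + u` for `t`. -/
lemma exists_explicit_bound {D K : ℝ} (hD : 0 < D) (hK : 0 < K) :
    ∃ C₁ > 0, ∃ C₂ > 0, ∀ x t u : ℝ, 0 ≤ x → 0 ≤ t → 0 ≤ u →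
      t ≤ x / D + K * √(t * Real.log (1 + t)) + u →
        t ≤ x / D + C₁ * √(x * Real.log (1 + x)) + C₂ * (1 + u) := by
  -- With `m = 4 / D`, either `t ≤ m * x` and `log (1 + t)` is comparable to `log (1 + x)`, or `x /
  -- D < t / 4` and the square root is absorbed into `t`.
  obtain ⟨m, hm⟩ : ∃ m, m = 4 / D := ⟨_, rfl⟩
  have hm0 : 0 < m := hm ▸ by positivity
  have hlm : 0 ≤ Real.log (1 + m) := Real.log_nonneg (by linarith)
  -- Chosen so that `2 * K ^ 2 * η = 1 / 8`.
  obtain ⟨η, hη⟩ : ∃ η, η = 1 / (16 * K ^ 2) := ⟨_, rfl⟩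
  have hη0 : 0 < η := hη ▸ by positivity
  obtain ⟨E, hE⟩ : ∃ E, E = 2 * K ^ 2 * (η + |Real.log η|) := ⟨_, rfl⟩
  have hE0 : 0 < E := hE ▸ by positivity
  refine ⟨K * √(m * (1 + 2 * Real.log (1 + m))), by positivity, m + 2 * E + 2, by positivity,
    fun x t u hx ht hu hle => ?_⟩
  have hlx : 0 ≤ Real.log (1 + x) := Real.log_nonneg (by linarith)
  have hlt : 0 ≤ Real.log (1 + t) := Real.log_nonneg (by linarith)
  have hxD : 0 ≤ x / D := by positivity
  have hu' : u ≤ (m + 2 * E + 2) * (1 + u) := by nlinarith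
  -- For `x ≥ 1` the bound `log (1 + x) ≥ 1 / 2` absorbs the additive `log (1 + m)`; for `x < 1`
  -- simply `t ≤ m`.
  rcases le_or_gt t (m * x) with hcase | hcase
  · rcases le_or_gt 1 x with hx1 | hx1
    · have hl2 : 1 / 2 ≤ Real.log (1 + x) := by
        have h1 : Real.log 2 ≤ Real.log (1 + x) := Real.log_le_log (by norm_num) (by linarith)
        have h2 := Real.log_two_gt_d9
        linarith
      have h1 : Real.log (1 + t) ≤ (1 + 2 * Real.log (1 + m)) * Real.log (1 + x) := by
        have h2 : Real.log (1 + t) ≤ Real.log ((1 + m) * (1 + x)) :=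
          Real.log_le_log (by linarith) (by nlinarith)
        rw [Real.log_mul (by positivity) (by positivity)] at h2
        nlinarith
      have h3 : √(t * Real.log (1 + t))
          ≤ √(m * (1 + 2 * Real.log (1 + m))) * √(x * Real.log (1 + x)) := by
        rw [← Real.sqrt_mul (by positivity)]
        refine Real.sqrt_le_sqrt ?_
        calc t * Real.log (1 + t)
            ≤ m * x * ((1 + 2 * Real.log (1 + m)) * Real.log (1 + x)) := by gcongr
          _ = _ := by ring
      have h4 := mul_le_mul_of_nonneg_left h3 hK.le
      rw [← mul_assoc] at h4
      linarith
    · have h1 : t ≤ m := hcase.trans (by nlinarith)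
      have h2 : 0 ≤ K * √(m * (1 + 2 * Real.log (1 + m))) * √(x * Real.log (1 + x)) := by
        positivity
      nlinarith
  · have h1 : x / D < t / 4 := by
      rw [hm] at hcase
      rw [div_lt_iff₀ hD]
      have := (mul_lt_mul_of_pos_right hcase hD)
      rw [show 4 / D * x * D = 4 * x by field_simp] at this
      linarith
    -- By the inequality of arithmetic and geometric means. Together, `x / D` and the square root
    -- use up at most `t / 2 + E`.
    have h2 : K * √(t * Real.log (1 + t)) ≤ t / 8 + 2 * K ^ 2 * Real.log (1 + t) := by
      have h3 : 0 ≤ t / 8 + 2 * K ^ 2 * Real.log (1 + t) := by positivity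
      have h4 : √(t * Real.log (1 + t)) * √(t * Real.log (1 + t)) = t * Real.log (1 + t) :=
        Real.mul_self_sqrt (by positivity)
      refine abs_le_of_sq_le_sq' ?_ h3 |>.2
      rw [mul_pow, sq (√(t * Real.log (1 + t))), h4]
      nlinarith [sq_nonneg (t / 8 - 2 * K ^ 2 * Real.log (1 + t))]
    have h5 : Real.log (1 + t) ≤ η * t + (η + |Real.log η|) := by
      have h6 := Real.log_le_sub_one_of_pos (show 0 < η * (1 + t) by positivity)
      rw [Real.log_mul hη0.ne' (by positivity)] at h6
      have := neg_abs_le (Real.log η)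
      linarith
    have h7 : 2 * K ^ 2 * Real.log (1 + t) ≤ t / 8 + E := by
      calc _ ≤ 2 * K ^ 2 * (η * t + (η + |Real.log η|)) := by gcongr
        _ = t / 8 + E := by
          rw [mul_add, ← hE, hη]
          field_simp
          ring
    have h8 : 0 ≤ K * √(m * (1 + 2 * Real.log (1 + m))) * √(x * Real.log (1 + x)) := by
      positivity
    nlinarith

/-! ### Pathwise bound on the duration -/

namespace ElimTaS

variable {H A O : Type*} [MeasurableSpace O] [Fintype H] [Fintype A]
  {M : SensingModel H A O} {h : H} {b c α δ : ℝ}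
  {Ω : Type*} [mΩ : MeasurableSpace Ω] {P : Measure Ω}

lemma card_wrong_champ_le [DecidableEq H] (X : ElimTaS M h b c α δ Ω P)
    (hfin : M.FiniteDivergence)
    (hb : 0 ≤ b) (hc : 0 ≤ c)
    {ω : Ω} {t : ℕ} (ht : (t : ℕ∞) < X.τ ω) {κ l y ε B : ℝ} (hκ : 0 < κ)
    (hl : 0 < l) (hy0 : 0 ≤ y) (hε : 0 < ε) (hB0 : 0 < B) (hB : ∀ a i g, M.d a i g ≤ B)
    (hεo : ∀ (i : H) (S : Finset H) (w : A → ℝ), i ∉ S → M.IsOracle i S w → ∀ g ∈ S,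
      ε ≤ ∑ a, w a * M.d a i g)
    (hy : ∀ g ≠ h, ∀ t,
      κ * (X.path ω).informative M t h g - l * (X.path ω).llr M t h g ≤ y) :
    (((Finset.Icc 1 t).filter fun s => (X.path ω).champ s ≠ h).card : ℝ)
        ≤ Fintype.card H * (B / ε * ((4 * y + l * b * Real.log (1 + t) + l * c) / κ
            + 3 * (Fintype.card A : ℝ) ^ 2)) := by
  have hlog0 : 0 ≤ Real.log (1 + t) :=
    Real.log_nonneg (by linarith [(Nat.cast_nonneg t : (0 : ℝ) ≤ t)])
  have hsub : ((Finset.Icc 1 t).filter fun s => (X.path ω).champ s ≠ h) ⊆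
      (Finset.univ.erase h).biUnion fun i =>
        ((Finset.Icc 1 t).filter fun s => (X.path ω).champ s = i ∧
            h ∈ (X.path ω).active M b c α δ s i) ∪
          ((Finset.Icc 1 t).filter fun s => (X.path ω).champ s = i ∧
            h ∉ (X.path ω).active M b c α δ s i) := by
    intro s hs
    obtain ⟨h1, h2⟩ := Finset.mem_filter.1 hs
    refine Finset.mem_biUnion.2 ⟨(X.path ω).champ s, by simp [h2], ?_⟩
    rw [Finset.mem_union, Finset.mem_filter, Finset.mem_filter]
    tauto
  have hcard := (Finset.card_le_card hsub).trans Finset.card_biUnion_le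
  have hcard' : (((Finset.Icc 1 t).filter fun s => (X.path ω).champ s ≠ h).card : ℝ)
      ≤ ∑ i ∈ Finset.univ.erase h,
        (((((Finset.Icc 1 t).filter fun s => (X.path ω).champ s = i ∧
            h ∈ (X.path ω).active M b c α δ s i) ∪
          ((Finset.Icc 1 t).filter fun s => (X.path ω).champ s = i ∧
            h ∉ (X.path ω).active M b c α δ s i)).card : ℕ) : ℝ) := by
    exact_mod_cast hcard
  refine hcard'.trans ((Finset.sum_le_card_nsmul _ _ (B / ε *
    ((4 * y + l * b * Real.log (1 + t) + l * c) / κ + 3 * (Fintype.card A : ℝ) ^ 2)) ?_).trans ?_)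
  · intro i hi
    have hih : i ≠ h := Finset.ne_of_mem_erase hi
    have h1 := X.card_wrong_champ_active_le hfin ht hih hκ hl hy0 hε hB0 hB hεo hy
    have h2 := X.card_wrong_champ_eliminated_le hfin hb hc ht hih hκ hl hy0 hε hB0 hB hεo hy
    refine (Nat.cast_le.2 (Finset.card_union_le _ _)).trans ?_
    rw [Nat.cast_add]
    refine (add_le_add h1 h2).trans (le_of_eq ?_)
    ring
  · rw [nsmul_eq_mul]
    gcongr
    exact Finset.card_le_univ _

/-- At the last round with the true champion, a surviving opponent has accumulated divergence at
least `D₀` per such round, up to tracking error, while its log-likelihood ratio is still below the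
threshold. -/
lemma baseRate_mul_le [DecidableEq H] [Nonempty A] (X : ElimTaS M h b c α δ Ω P)
    (hb : 0 ≤ b) (hc : 0 ≤ c) (hx : 0 ≤ α * Real.log (1 / δ))
    {ω : Ω} {t : ℕ} (ht : (t : ℕ∞) < X.τ ω) {ρ B : ℝ} {v : ℝ≥0} (hρ0 : 0 ≤ ρ)
    (hB0 : 0 < B) (hB : ∀ a i g, M.d a i g ≤ B)
    (hρ : ∀ g ≠ h, ∀ t : ℕ, (X.path ω).divergence M t h g - (X.path ω).llr M t h g
      - deviationRadius v t ≤ ρ) :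
    M.baseRate h * t ≤ M.baseRate h *
        (((Finset.Icc 1 t).filter fun s => (X.path ω).champ s ≠ h).card : ℝ)
      + (α * Real.log (1 / δ) + b * Real.log (1 + t) + c + deviationRadius v t + ρ
          + (Fintype.card A : ℝ) ^ 2 * B) := by
  have hlog : ∀ s : ℕ, s ≤ t → Real.log (1 + s) ≤ Real.log (1 + t) := fun s hs => by
    have : (s : ℝ) ≤ t := by exact_mod_cast hs
    exact Real.log_le_log (by positivity) (by linarith)
  have hlog0 : ∀ s : ℕ, 0 ≤ Real.log (1 + s) := fun s =>
    Real.log_nonneg (by linarith [(Nat.cast_nonneg s : (0 : ℝ) ≤ s)])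
  have hdev0 : 0 ≤ deviationRadius v t := by unfold deviationRadius; positivity
  have hlogt := hlog0 t
  set T := (Finset.Icc 1 t).filter fun s => (X.path ω).champ s = h with hT
  have hcount : (t : ℝ) = T.card +
      (((Finset.Icc 1 t).filter fun s => (X.path ω).champ s ≠ h).card : ℝ) := by
    have := Finset.card_filter_add_card_filter_not (s := Finset.Icc 1 t)
      (fun s => (X.path ω).champ s = h)
    rw [Nat.card_Icc, Nat.add_sub_cancel] at this
    exact_mod_cast this.symm
  have main : M.baseRate h * T.card ≤ α * Real.log (1 / δ) + b * Real.log (1 + t) + c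
      + deviationRadius v t + ρ + (Fintype.card A : ℝ) ^ 2 * B := by
    rcases T.eq_empty_or_nonempty with h0 | hne
    · rw [h0]
      simp only [Finset.card_empty, Nat.cast_zero, mul_zero]
      positivity
    have hm := T.max'_mem hne
    set s₀ := T.max' hne
    obtain ⟨hs1, hs2⟩ := Finset.mem_Icc.1 (Finset.mem_filter.1 hm).1
    have hch := (Finset.mem_filter.1 hm).2
    have hs0 : (s₀ : ℕ∞) < X.τ ω := lt_of_le_of_lt (Nat.cast_le.2 hs2) ht
    have hsub : T ⊆ Finset.Icc 1 s₀ := fun s hs =>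
      Finset.mem_Icc.2 ⟨(Finset.mem_Icc.1 (Finset.mem_filter.1 hs).1).1, T.le_max' s hs⟩
    obtain ⟨g, hg⟩ := SamplePath.active_champ_nonempty hs1 hs0
    rw [hch] at hg
    have hgh : g ≠ h := (SamplePath.mem_active.1 hg).1
    have hcard := X.mul_card_le hs0 (q := fun a => M.d a h g) (ε := M.baseRate h)
      (fun a => M.d_nonneg _ _ _) (fun a => hB a h g) hsub fun s hs => by
        obtain ⟨hs', hc'⟩ := Finset.mem_filter.1 hs
        have hsτ : (s : ℕ∞) < X.τ ω :=
          lt_of_le_of_lt (Nat.cast_le.2 (Finset.mem_Icc.1 hs').2) ht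
        have ho := X.target_oracle ω s hsτ
        rw [hc'] at ho
        exact M.baseRate_le h (fun hmem => (SamplePath.mem_active.1 hmem).1 rfl) ho
          ((X.path ω).active_anti M b c α δ h (T.le_max' s hs) hg)
    have h1 := hρ g hgh s₀
    have h2 := (SamplePath.mem_active.1 hg).2 s₀ hs1 le_rfl hch
    have h3 : b * Real.log s₀ ≤ b * Real.log (1 + t) := by
      have : Real.log s₀ ≤ Real.log (1 + s₀) :=
        Real.log_le_log (by exact_mod_cast hs1) (by linarith)
      exact mul_le_mul_of_nonneg_left (this.trans (hlog s₀ hs2)) hb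
    have h4 : deviationRadius v s₀ ≤ deviationRadius v t := by
      have := hlog s₀ hs2
      have := hlog0 s₀
      unfold deviationRadius
      gcongr
    rw [elimThreshold] at h2
    change _ ≤ (X.path ω).divergence M s₀ h g + _ at hcard
    linarith
  calc M.baseRate h * t = M.baseRate h * T.card + M.baseRate h *
        (((Finset.Icc 1 t).filter fun s => (X.path ω).champ s ≠ h).card : ℝ) := by
        rw [← mul_add, ← hcount]
    _ ≤ _ := by linarith

/-- Up to random variables `y`, `ρ`, the duration of a run is at most `x / D₀` plus a term of order
`√(x log (1 + x))`, where `x = α log (1 / δ)`. -/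
lemma exists_duration_bound [DecidableEq H] [Nontrivial H] [Nonempty A]
    (hfin : M.FiniteDivergence) (hid : M.Identifiable) (h : H) (v : ℝ≥0)
    (hb : 0 ≤ b) (hc : 0 ≤ c) {κ l : ℝ} (hκ : 0 < κ) (hl : 0 < l) :
    ∃ C₁ > 0, ∃ C₂ > 0, ∀ (α δ : ℝ), 0 ≤ α * Real.log (1 / δ) →
      ∀ (Ω : Type*) [MeasurableSpace Ω] (P : Measure Ω) (X : ElimTaS M h b c α δ Ω P) (ω : Ω)
        (y ρ : ℝ), 0 ≤ y → 0 ≤ ρ →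
        (∀ g ≠ h, ∀ t,
          κ * (X.path ω).informative M t h g - l * (X.path ω).llr M t h g ≤ y) →
        (∀ g ≠ h, ∀ t : ℕ, (X.path ω).divergence M t h g - (X.path ω).llr M t h g
          - deviationRadius v t ≤ ρ) →
        ∀ t : ℕ, (t : ℕ∞) < X.τ ω →
          (t : ℝ) ≤ α * Real.log (1 / δ) / M.baseRate h
            + C₁ * √(α * Real.log (1 / δ) * Real.log (1 + α * Real.log (1 / δ)))
            + C₂ * (1 + y + ρ) := by
  obtain ⟨B, hB0, hB⟩ := M.exists_d_upper
  obtain ⟨ε, hε, hεo⟩ := M.exists_oracle_lower hid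
  have hD := M.baseRate_pos hid h
  set D := M.baseRate h with hDdef
  obtain ⟨N, hN⟩ : ∃ N : ℝ, N = Fintype.card H * (B / ε) := ⟨_, rfl⟩
  have hN0 : 0 ≤ N := hN ▸ by positivity
  obtain ⟨Q, hQ⟩ : ∃ Q : ℝ, Q = (Fintype.card A : ℝ) ^ 2 := ⟨_, rfl⟩
  have hQ0 : 0 ≤ Q := hQ ▸ by positivity
  -- `K` collects the coefficients of `log (1 + t)`, from the wrong champions and the threshold, and
  -- of the deviation radius, because `log (1 + t) ≤ √(t log (1 + t))`.
  obtain ⟨C₁, hC₁, C₂, hC₂, hbound⟩ := exists_explicit_bound (D := D)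
    (K := N * (l * b / κ) + b / D + (v / 2 + 3) / D) hD (by positivity)
  obtain ⟨U, hU⟩ : ∃ U : ℝ,
      U = N * (4 / κ) + (N * (l * c / κ + 3 * Q) + c / D + Q * B / D) + 1 / D := ⟨_, rfl⟩
  have hU0 : 0 ≤ U := hU ▸ by positivity
  refine ⟨C₁, hC₁, C₂ * (1 + U), by positivity, ?_⟩
  intro α δ hx Ω _ P X ω y ρ hy0 hρ0 hy hρ t ht
  have hw := X.card_wrong_champ_le hfin hb hc ht hκ hl hy0 hε hB0 hB hεo hy
  have hm := X.baseRate_mul_le hb hc hx ht hρ0 hB0 hB hρ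
  rw [← hDdef, ← hQ] at hm
  rw [← mul_assoc, ← hN, ← hQ] at hw
  set x := α * Real.log (1 / δ)
  set W := (((Finset.Icc 1 t).filter fun s => (X.path ω).champ s ≠ h).card : ℝ)
  set L := Real.log (1 + t)
  set s := √(t * L) with hs
  have hL : L ≤ s := log_one_add_le_sqrt (Nat.cast_nonneg t)
  have ht1 : (t : ℝ) ≤ W + (x + b * L + c + deviationRadius v t + ρ + Q * B) / D := by
    have := div_le_div_of_nonneg_right hm hD.le
    rwa [mul_div_cancel_left₀ _ hD.ne', add_div, mul_div_cancel_left₀ _ hD.ne'] at this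
  have hdev : deviationRadius v t = (v / 2 + 3) * s := rfl
  have h1 : (t : ℝ) ≤ x / D + (N * (l * b / κ) + b / D + (v / 2 + 3) / D) * s
      + U * (1 + y + ρ) := by
    calc (t : ℝ) ≤ N * ((4 * y + l * b * L + l * c) / κ + 3 * Q)
          + (x + b * L + c + (v / 2 + 3) * s + ρ + Q * B) / D := by
          rw [← hdev]; linarith
      _ ≤ N * ((4 * y + l * b * s + l * c) / κ + 3 * Q)
          + (x + b * s + c + (v / 2 + 3) * s + ρ + Q * B) / D := by gcongr
      _ = x / D + (N * (l * b / κ) + b / D + (v / 2 + 3) / D) * s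
          + (N * (4 / κ) * y + (N * (l * c / κ + 3 * Q) + c / D + Q * B / D) * 1
            + 1 / D * ρ) := by ring
      _ ≤ _ := by
          rw [hU]
          have e1 : 0 ≤ N * (4 / κ) := by positivity
          have e2 : 0 ≤ N * (l * c / κ + 3 * Q) + c / D + Q * B / D := by positivity
          have e3 : 0 ≤ 1 / D := by positivity
          nlinarith [mul_nonneg e1 hρ0, mul_nonneg e2 hρ0, mul_nonneg e2 hy0, mul_nonneg e3 hy0]
  have h2 := hbound x t _ hx (Nat.cast_nonneg t) (by positivity) h1
  refine h2.trans ?_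
  have : 1 + U * (1 + y + ρ) ≤ (1 + U) * (1 + y + ρ) := by nlinarith
  have := mul_le_mul_of_nonneg_left this hC₂.le
  linarith

end ElimTaS

/-! ### A path determines its chain -/

lemma Fin.exists_castSucc_le_lt_succ {n : ℕ} {T : Fin (n + 1) → ℕ} {t : ℕ} (h0 : T 0 ≤ t)
    (h1 : t < T (Fin.last n)) : ∃ k : Fin n, T k.castSucc ≤ t ∧ t < T k.succ := by
  by_contra! hk
  exact absurd (Fin.induction (motive := fun k => T k ≤ t) h0 (fun k => hk k) (Fin.last n))
    (not_le.2 h1)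

namespace ElimChain

variable {H : Type*} [Fintype H] [DecidableEq H] {h : H}

/-- Injectivity recovers the length from the range, and a strictly monotone enumeration of a given
set is unique. -/
lemma eq_of_range_eq {σ σ' : ElimChain h} (e : Set.range σ.S = Set.range σ'.S) : σ = σ' := by
  have hlen : σ.len = σ'.len := by
    have := congrArg Set.ncard e
    rw [← Set.image_univ, ← Set.image_univ, Set.ncard_image_of_injective _ σ.anti.injective,
      Set.ncard_image_of_injective _ σ'.anti.injective, Set.ncard_univ, Set.ncard_univ] at this
    simpa using this
  obtain ⟨n, S, h1, h2, h3⟩ := σ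
  obtain ⟨n', S', h1', h2', h3'⟩ := σ'
  obtain rfl : n = n' := hlen
  have : S = S' := by
    have hr := (StrictMono.range_inj h3.dual_right h3'.dual_right).1
      (by rw [Set.range_comp, Set.range_comp]; exact congrArg _ e)
    funext k
    exact OrderDual.toDual.injective (congrFun hr k)
  subst this
  rfl

end ElimChain

namespace SamplePath

variable {H A O : Type*} [MeasurableSpace O] [Fintype H]

lemma stopTime_eq_coe_iff {M : SensingModel H A O} {b c α δ : ℝ} {x : SamplePath H A O} {n : ℕ} :
    x.stopTime M b c α δ = n ↔
      (1 ≤ n ∧ x.active M b c α δ n (x.champ n) = ∅) ∧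
        ∀ m < n, 1 ≤ m → x.active M b c α δ m (x.champ m) ≠ ∅ := by
  have hle : ∀ m : ℕ, 1 ≤ m ∧ x.active M b c α δ m (x.champ m) = ∅ →
      x.stopTime M b c α δ ≤ m := fun m hm => iInf₂_le m hm
  have hge : ∀ n : ℕ, (∀ m < n, 1 ≤ m → x.active M b c α δ m (x.champ m) ≠ ∅) →
      (n : ℕ∞) ≤ x.stopTime M b c α δ := fun n hn => le_iInf₂ fun m hm => by
    by_contra! hlt
    exact hn m (Nat.cast_lt.1 hlt) hm.1 hm.2
  constructor
  · intro e
    have h2 : ∀ m < n, 1 ≤ m → x.active M b c α δ m (x.champ m) ≠ ∅ := fun m hm h1 h0 => by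
      have := hle m ⟨h1, h0⟩
      rw [e, Nat.cast_le] at this
      omega
    refine ⟨?_, h2⟩
    by_contra hn
    have h3 := hge (n + 1) fun m hm h1 h0 => by
      rcases Nat.lt_succ_iff_lt_or_eq.1 hm with h' | rfl
      · exact h2 m h' h1 h0
      · exact hn ⟨h1, h0⟩
    rw [e, Nat.cast_le] at h3
    omega
  · rintro ⟨h1, h2⟩
    exact le_antisymm (hle n h1) (hge n h2)

/-- The right-hand side does not mention `σ`, which is what makes the chain events disjoint. The set
`∅` is inserted because it is the last term of the chain, reached only at `τ`. -/
lemma Follows.range_eq [DecidableEq H] {h : H} {M : SensingModel H A O} {b c α δ : ℝ}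
    {σ : ElimChain h} {x : SamplePath H A O} (hf : x.Follows M b c α δ σ) :
    Set.range σ.S = insert ∅ ((fun t => x.active M b c α δ t h) ''
      {t : ℕ | (t : ℕ∞) < x.stopTime M b c α δ}) := by
  obtain ⟨T, hT, hT0, hend, -, hact⟩ := hf
  rw [hend]
  ext F
  constructor
  · rintro ⟨k, rfl⟩
    induction k using Fin.lastCases with
    | last => exact Or.inl σ.finish
    | cast k =>
      have h1 : T k.castSucc < T k.succ := hT (Fin.castSucc_lt_succ)
      refine Or.inr ⟨T k.castSucc, ?_, hact k _ le_rfl h1⟩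
      exact (Nat.cast_lt (α := ℕ∞)).2 (h1.trans_le (hT.monotone (Fin.le_last _)))
  · rintro (rfl | ⟨t, ht, rfl⟩)
    · exact ⟨_, σ.finish⟩
    · obtain ⟨k, h1, h2⟩ := Fin.exists_castSucc_le_lt_succ (T := T) (t := t) (by omega)
        ((Nat.cast_lt (α := ℕ∞)).1 ht)
      exact ⟨_, (hact k t h1 h2).symm⟩

end SamplePath

/-! ### Measurability, disjointness and additivity of the chain events -/

namespace ElimTaS

variable {H A O : Type*} [MeasurableSpace O] [Fintype H] [Fintype A]
  {M : SensingModel H A O} {h : H} {b c α δ : ℝ}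
  {Ω : Type*} [mΩ : MeasurableSpace Ω] {P : Measure Ω}

lemma measurable_llr (X : ElimTaS M h b c α δ Ω P) (t : ℕ) (i g : H) :
    Measurable fun ω => (X.path ω).llr M t i g := by
  simp_rw [SamplePath.llr_eq_sum]
  refine Finset.measurable_sum _ fun k hk => ?_
  obtain ⟨k, rfl⟩ := Nat.exists_eq_succ_of_ne_zero
    (Nat.one_le_iff_ne_zero.1 (Finset.mem_Icc.1 hk).1)
  exact (X.measurable_act_obs (fun a => M.measurable_logRatio a i g) k).mono (X.ℱ.le _) le_rfl

lemma measurableSet_champ (X : ElimTaS M h b c α δ Ω P) (t : ℕ) (i : H) :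
    MeasurableSet {ω | (X.path ω).champ t = i} :=
  X.ℱ.le t _ (X.champ_meas t i)

lemma measurableSet_mem_active (X : ElimTaS M h b c α δ Ω P) (t : ℕ) (i g : H) :
    MeasurableSet {ω | g ∈ (X.path ω).active M b c α δ t i} := by
  have : {ω | g ∈ (X.path ω).active M b c α δ t i} = {_ω | g ≠ i} ∩ ⋂ s : ℕ, ⋂ (_ : 1 ≤ s),
      ⋂ (_ : s ≤ t), ({ω | (X.path ω).champ s = i}ᶜ ∪
        {ω | (X.path ω).llr M s i g < elimThreshold b c α δ s}) := by
    ext ω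
    simp [SamplePath.mem_active, imp_iff_not_or]
  rw [this]
  exact (MeasurableSet.const _).inter (MeasurableSet.iInter fun s => MeasurableSet.iInter fun _ =>
    MeasurableSet.iInter fun _ => (X.measurableSet_champ s i).compl.union
      (measurableSet_lt (X.measurable_llr s i g) measurable_const))

lemma measurableSet_active_eq (X : ElimTaS M h b c α δ Ω P) (t : ℕ) (i : H) (F : Finset H) :
    MeasurableSet {ω | (X.path ω).active M b c α δ t i = F} := by
  have : {ω | (X.path ω).active M b c α δ t i = F}
      = ⋂ g, {ω | g ∈ (X.path ω).active M b c α δ t i ↔ g ∈ F} := by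
    ext ω
    simp [Finset.ext_iff]
  rw [this]
  refine MeasurableSet.iInter fun g => ?_
  by_cases hg : g ∈ F
  · simpa [hg] using X.measurableSet_mem_active t i g
  · have := (X.measurableSet_mem_active t i g).compl
    rwa [show {ω | g ∈ (X.path ω).active M b c α δ t i ↔ g ∈ F}
      = {ω | g ∈ (X.path ω).active M b c α δ t i}ᶜ by ext; simp [hg]]

lemma measurableSet_active_champ_eq_empty (X : ElimTaS M h b c α δ Ω P) (t : ℕ) :
    MeasurableSet {ω | (X.path ω).active M b c α δ t ((X.path ω).champ t) = ∅} := by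
  have : {ω | (X.path ω).active M b c α δ t ((X.path ω).champ t) = ∅}
      = ⋃ i, ({ω | (X.path ω).champ t = i} ∩ {ω | (X.path ω).active M b c α δ t i = ∅}) := by
    ext ω
    simp
  rw [this]
  exact MeasurableSet.iUnion fun i =>
    (X.measurableSet_champ t i).inter (X.measurableSet_active_eq t i ∅)

lemma measurableSet_stopTime_eq (X : ElimTaS M h b c α δ Ω P) (n : ℕ) :
    MeasurableSet {ω | (X.path ω).stopTime M b c α δ = n} := by
  have : {ω | (X.path ω).stopTime M b c α δ = n}
      = ({_ω | 1 ≤ n} ∩ {ω | (X.path ω).active M b c α δ n ((X.path ω).champ n) = ∅}) ∩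
        ⋂ m : ℕ, ⋂ (_ : m < n), ⋂ (_ : 1 ≤ m),
          {ω | (X.path ω).active M b c α δ m ((X.path ω).champ m) = ∅}ᶜ := by
    ext ω
    simp [SamplePath.stopTime_eq_coe_iff]
  rw [this]
  exact ((MeasurableSet.const _).inter (X.measurableSet_active_champ_eq_empty n)).inter
    (MeasurableSet.iInter fun m => MeasurableSet.iInter fun _ => MeasurableSet.iInter fun _ =>
      (X.measurableSet_active_champ_eq_empty m).compl)

variable [DecidableEq H]

/-- There are only countably many possible vectors of switching times. -/
lemma measurableSet_chainEvent (X : ElimTaS M h b c α δ Ω P) (σ : ElimChain h) :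
    MeasurableSet (X.chainEvent σ) := by
  have : X.chainEvent σ = ⋃ T : Fin (σ.len + 1) → ℕ, (({_ω | StrictMono T} ∩ {_ω | T 0 = 0}) ∩
      (({ω | (X.path ω).stopTime M b c α δ = (T (Fin.last σ.len) : ℕ∞)} ∩
        {ω | (X.path ω).champ (T (Fin.last σ.len)) = h}) ∩
        ⋂ k : Fin σ.len, ⋂ t : ℕ, ⋂ (_ : T k.castSucc ≤ t), ⋂ (_ : t < T k.succ),
          {ω | (X.path ω).active M b c α δ t h = σ.S k.castSucc})) := by
    ext ω
    simp [chainEvent, SamplePath.Follows, and_assoc]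
  rw [this]
  exact MeasurableSet.iUnion fun T => ((MeasurableSet.const _).inter (MeasurableSet.const _)).inter
    (((X.measurableSet_stopTime_eq _).inter (X.measurableSet_champ _ _)).inter
      (MeasurableSet.iInter fun k => MeasurableSet.iInter fun t => MeasurableSet.iInter fun _ =>
        MeasurableSet.iInter fun _ => X.measurableSet_active_eq t h _))

lemma disjoint_chainEvent (X : ElimTaS M h b c α δ Ω P) {σ σ' : ElimChain h} (hne : σ ≠ σ') :
    Disjoint (X.chainEvent σ) (X.chainEvent σ') :=
  Set.disjoint_left.2 fun _ h1 h2 => hne (ElimChain.eq_of_range_eq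
    ((SamplePath.Follows.range_eq h1).trans (SamplePath.Follows.range_eq h2).symm))

lemma measureReal_corrEvent [IsProbabilityMeasure P] (X : ElimTaS M h b c α δ Ω P)
    (F : Finset (ElimChain h)) :
    P.real (X.corrEvent F) = ∑ σ ∈ F, P.real (X.chainEvent σ) :=
  measureReal_biUnion_finset (fun _ _ _ _ hne => X.disjoint_chainEvent hne)
    fun σ _ => X.measurableSet_chainEvent σ

lemma expTime_corrEvent (X : ElimTaS M h b c α δ Ω P) (F : Finset (ElimChain h)) :
    X.expTime (X.corrEvent F) = ∑ σ ∈ F, X.expTime (X.chainEvent σ) := by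
  have h1 := fun σ : ElimChain h => X.measurableSet_chainEvent σ
  simp only [expTime, corrEvent]
  rw [lintegral_indicator (Finset.measurableSet_biUnion F fun σ _ => h1 σ),
    lintegral_biUnion_finset (fun _ _ _ _ hne => X.disjoint_chainEvent hne)
      fun σ _ => h1 σ]
  exact Finset.sum_congr rfl fun σ _ => (lintegral_indicator (h1 σ) _).symm

/-! ### Integration and conclusion -/

/-- The expected duration on an event on which the run stops. -/
lemma exists_expTime_bound [Nontrivial H] [Nonempty A]
    (hfin : M.FiniteDivergence) (hid : M.Identifiable) (h : H) (v : ℝ≥0)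
    (hv : M.SubGaussianIncrements h v) (hb : 0 ≤ b) (hc : 0 ≤ c) :
    ∃ C₁ > 0, ∃ C₃ > 0, ∀ α : ℝ, 0 < α → α ≤ 1 → ∀ δ : ℝ, 0 < δ → δ < 1 →
      ∀ (Ω : Type*) [MeasurableSpace Ω] (P : Measure Ω) [IsProbabilityMeasure P]
        (X : ElimTaS M h b c α δ Ω P) (E : Set Ω), MeasurableSet E → (∀ ω ∈ E, X.τ ω ≠ ⊤) →
        X.expTime E ≤ ENNReal.ofReal (P.real E *
          (α * Real.log (1 / δ) / M.baseRate h
            + C₁ * √(Real.log (1 / δ) * Real.log (1 + Real.log (1 / δ)))) + C₃) := by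
  obtain ⟨ε, hε, hlow⟩ := M.exists_d_lower
  have hv1 : (0 : ℝ) < v + 1 := by positivity
  -- As `v * l ≤ ε`, the variance term is at most `l * ε / 2`; with `κ = l * ε / 2` the drift `l * d
  -- ≥ l * ε` covers both. The `+ 1` allows `v = 0`.
  obtain ⟨l, hl⟩ : ∃ l, l = ε / (v + 1) := ⟨_, rfl⟩
  have hl0 : 0 < l := hl ▸ by positivity
  have hlv : (v + 1) * l = ε := by rw [hl]; field_simp
  have hκ : ∀ a g, M.d a h g ≠ 0 → l * ε / 2 - l * M.d a h g + v * l ^ 2 / 2 ≤ 0 := by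
    intro a g hd
    have h1 := hlow a h g (lt_of_le_of_ne (M.d_nonneg _ _ _) (Ne.symm hd))
    nlinarith [sq_nonneg l]
  obtain ⟨C₁, hC₁, C₂, hC₂, hdur⟩ :=
    exists_duration_bound (M := M) hfin hid h v hb hc (κ := l * ε / 2) (by positivity) hl0
  set S₁ : ℝ≥0∞ := ∑' n : ℕ, ENNReal.ofReal (Real.exp (-(n : ℝ)))
  set S₂ : ℝ≥0∞ := ∑' n : ℕ, ENNReal.ofReal (2 * (1 / ((n : ℝ) + 1) ^ 2))
  have hS₁ : S₁ ≠ ⊤ := by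
    refine Summable.tsum_ofReal_ne_top ?_
    exact Real.summable_exp_neg_nat
  have hS₂ : S₂ ≠ ⊤ := by
    refine Summable.tsum_ofReal_ne_top (Summable.mul_left 2 ?_)
    exact_mod_cast (summable_nat_add_iff 1).2 (Real.summable_one_div_nat_pow.2 one_lt_two)
  set K : ℝ≥0∞ := 1 + ENNReal.ofReal C₂ *
    (1 + (Fintype.card {g // g ≠ h} * S₁ + Fintype.card {g // g ≠ h} * S₂)) with hK
  have hKtop : K ≠ ⊤ := by finiteness
  have hK1 : 1 ≤ K := le_self_add
  refine ⟨C₁, hC₁, K.toReal, ENNReal.toReal_pos (one_pos.trans_le hK1).ne' hKtop, ?_⟩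
  intro α hα0 hα1 δ hδ0 hδ1 Ω _ P _ X E hE hτ
  have hL : 0 ≤ Real.log (1 / δ) := Real.log_nonneg ((one_le_div hδ0).2 hδ1.le)
  set L := Real.log (1 / δ)
  have hx : 0 ≤ α * L := by positivity
  have hxL : α * L ≤ L := mul_le_of_le_one_left hL hα1
  have hD := M.baseRate_pos hid h
  choose Y hYm hY hYle using fun g : {g // g ≠ h} =>
    X.exists_surplus_bound hfin hv g.2 (κ := l * ε / 2) (l := l) (fun a => hκ a g)
  choose R hRm hR hRle using fun g : {g // g ≠ h} => X.exists_shortfall_bound hfin hv g.2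
  obtain ⟨r, hr⟩ : ∃ r, r = α * L / M.baseRate h + C₁ * √(L * Real.log (1 + L)) := ⟨_, rfl⟩
  have hlogL : 0 ≤ Real.log (1 + L) := Real.log_nonneg (by linarith)
  have hr0 : 0 ≤ r := hr ▸ by positivity
  -- Only the deterministic `r` keeps the indicator of `E`; the random remainder is bounded on the
  -- whole space. The leading `1` accounts for applying the duration bound at `τ - 1`.
  have hpt : ∀ ω, E.indicator (fun ω => (X.τ ω : ℝ≥0∞)) ω
      ≤ E.indicator (fun _ => ENNReal.ofReal r) ω
        + (1 + ENNReal.ofReal C₂ * (1 + (∑ g, Y g ω + ∑ g, R g ω))) := by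
    intro ω
    by_cases hω : ω ∈ E
    swap
    · simp [hω]
    rw [Set.indicator_of_mem hω, Set.indicator_of_mem hω]
    -- Where the random remainder is infinite there is nothing to prove, as `C₂ > 0`.
    by_cases hYR : ∑ g, Y g ω + ∑ g, R g ω = ⊤
    · have : ENNReal.ofReal C₂ ≠ 0 := by simpa using hC₂
      simp [hYR, ENNReal.mul_top this]
    obtain ⟨hYt, hRt⟩ := ENNReal.add_ne_top.1 hYR
    obtain ⟨n, hn⟩ := ENat.ne_top_iff_exists.1 (hτ ω hω)
    rcases Nat.eq_zero_or_pos n with rfl | hpos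
    · rw [← hn]; simp
    obtain ⟨t, rfl⟩ := Nat.exists_eq_succ_of_ne_zero hpos.ne'
    have ht : (t : ℕ∞) < X.τ ω := by
      rw [← hn]
      exact Nat.cast_lt.2 (Nat.lt_succ_self t)
    have hmain := hdur α δ hx Ω P X ω (∑ g, Y g ω).toReal (∑ g, R g ω).toReal
      ENNReal.toReal_nonneg ENNReal.toReal_nonneg
      (fun g hg t => (ENNReal.ofReal_le_iff_le_toReal hYt).1 ((hYle ⟨g, hg⟩ ω t).trans
        (Finset.single_le_sum (f := fun g => Y g ω) (fun _ _ => zero_le)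
          (Finset.mem_univ (⟨g, hg⟩ : {g // g ≠ h})))))
      (fun g hg t => (ENNReal.ofReal_le_iff_le_toReal hRt).1 ((hRle ⟨g, hg⟩ ω t).trans
        (Finset.single_le_sum (f := fun g => R g ω) (fun _ _ => zero_le)
          (Finset.mem_univ (⟨g, hg⟩ : {g // g ≠ h}))))) t ht
    have hsq : √(α * L * Real.log (1 + α * L)) ≤ √(L * Real.log (1 + L)) := by
      have h0 : 0 ≤ Real.log (1 + α * L) := Real.log_nonneg (by linarith)
      have h1 : Real.log (1 + α * L) ≤ Real.log (1 + L) :=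
        Real.log_le_log (by linarith) (by linarith)
      exact Real.sqrt_le_sqrt (by gcongr)
    have hfin' : (t : ℝ) + 1 ≤ r + (1 + C₂ * (1 + ((∑ g, Y g ω).toReal
        + (∑ g, R g ω).toReal))) := by
      have := mul_le_mul_of_nonneg_left hsq hC₁.le
      rw [hr]
      linarith
    have hcast : (X.τ ω : ℝ≥0∞) = ENNReal.ofReal ((t : ℝ) + 1) := by
      rw [← hn, ← Nat.cast_succ, ENNReal.ofReal_natCast]
      rfl
    rw [hcast]
    refine (ENNReal.ofReal_le_ofReal hfin').trans (le_of_eq ?_)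
    have e1 : 0 ≤ (∑ g, Y g ω).toReal := ENNReal.toReal_nonneg
    have e2 : 0 ≤ (∑ g, R g ω).toReal := ENNReal.toReal_nonneg
    rw [ENNReal.ofReal_add hr0 (by positivity), ENNReal.ofReal_add zero_le_one (by positivity),
      ENNReal.ofReal_mul hC₂.le, ENNReal.ofReal_add zero_le_one (by positivity),
      ENNReal.ofReal_add e1 e2, ENNReal.ofReal_toReal hYt, ENNReal.ofReal_toReal hRt,
      ENNReal.ofReal_one]
  have hYint : ∫⁻ ω, ∑ g, Y g ω ∂P ≤ Fintype.card {g // g ≠ h} * S₁ := by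
    rw [lintegral_finsetSum _ fun g _ => hYm g]
    refine (Finset.sum_le_card_nsmul _ _ S₁ fun g _ => hY g).trans (le_of_eq ?_)
    rw [nsmul_eq_mul, Finset.card_univ]
  have hRint : ∫⁻ ω, ∑ g, R g ω ∂P ≤ Fintype.card {g // g ≠ h} * S₂ := by
    rw [lintegral_finsetSum _ fun g _ => hRm g]
    refine (Finset.sum_le_card_nsmul _ _ S₂ fun g _ => hR g).trans (le_of_eq ?_)
    rw [nsmul_eq_mul, Finset.card_univ]
  have hYm' : Measurable fun ω => ∑ g, Y g ω := Finset.measurable_sum _ fun g _ => hYm g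
  calc X.expTime E ≤ ∫⁻ ω, (E.indicator (fun _ => ENNReal.ofReal r) ω
        + (1 + ENNReal.ofReal C₂ * (1 + (∑ g, Y g ω + ∑ g, R g ω)))) ∂P := lintegral_mono hpt
    _ = ENNReal.ofReal r * P E + (1 + ENNReal.ofReal C₂ *
          (1 + (∫⁻ ω, ∑ g, Y g ω ∂P + ∫⁻ ω, ∑ g, R g ω ∂P))) := by
        rw [lintegral_add_left (measurable_const.indicator hE), lintegral_indicator_const hE,
          lintegral_add_left measurable_const, lintegral_const_mul' _ _ ENNReal.ofReal_ne_top,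
          lintegral_add_left measurable_const, lintegral_add_left hYm']
        simp
    _ ≤ ENNReal.ofReal r * P E + K := by
        rw [hK]
        gcongr
    _ = _ := by
        rw [← hr, ENNReal.ofReal_add (by positivity) ENNReal.toReal_nonneg,
          ENNReal.ofReal_toReal hKtop, mul_comm (P.real E), ENNReal.ofReal_mul hr0,
          ofReal_measureReal]

end ElimTaS

theorem proposition2 {H A O : Type*} [Fintype H] [DecidableEq H] [Nontrivial H] [Fintype A]
    [MeasurableSpace O] (M : SensingModel H A O) (hfin : M.FiniteDivergence)
    (hid : M.Identifiable) (h : H) (v : ℝ≥0) (hv : M.SubGaussianIncrements h v)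
    (b c : ℝ) (hb : 0 < b) (hc : 0 < c) :
    ∃ C₁ C₂ C₃ : ElimChain h → ℝ,
      (∀ σ, 0 < C₁ σ ∧ 0 < C₂ σ ∧ 0 < C₃ σ) ∧
      ∀ α : ℝ, 0 < α → α ≤ 1 → ∀ δ : ℝ, 0 < δ → δ < 1 →
      ∀ (Ω : Type*) [MeasurableSpace Ω] (P : Measure Ω) [IsProbabilityMeasure P]
        (X : ElimTaS M h b c α δ Ω P),
        -- the chain events are pairwise disjoint
        (∀ σ σ' : ElimChain h, σ ≠ σ' → Disjoint (X.chainEvent σ) (X.chainEvent σ')) ∧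
        -- the bound along each fixed chain
        (∀ σ : ElimChain h,
          X.expTime (X.chainEvent σ) ≤ ENNReal.ofReal
            (P.real (X.chainEvent σ) *
                (α * Real.log (1 / δ) / M.baseRate h
                  + b / M.baseRate h * Real.log (1 + Real.log (1 / δ))
                  + C₁ σ * √(Real.log (1 / δ) * Real.log (1 + Real.log (1 / δ)))
                  + C₂ σ * Real.log (1 + Real.log (1 / δ)) ^ 2)
              + C₃ σ)) ∧
        -- aggregation over a family of chains; `Finset.univ` is the family of all chains
        ∀ F : Finset (ElimChain h),
          P.real (X.corrEvent F) = ∑ σ ∈ F, P.real (X.chainEvent σ) ∧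
          X.expTime (X.corrEvent F) = ∑ σ ∈ F, X.expTime (X.chainEvent σ) ∧
          X.expTime (X.corrEvent F) ≤ ENNReal.ofReal
            (P.real (X.corrEvent F) *
                (α * Real.log (1 / δ) / M.baseRate h
                  + b / M.baseRate h * Real.log (1 + Real.log (1 / δ)))
              + ∑ σ ∈ F, P.real (X.chainEvent σ) * C₁ σ
                  * √(Real.log (1 / δ) * Real.log (1 + Real.log (1 / δ)))
              + ∑ σ ∈ F, P.real (X.chainEvent σ) * C₂ σ
                  * Real.log (1 + Real.log (1 / δ)) ^ 2
              + ∑ σ ∈ F, C₃ σ) := by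
  -- Two distinct hypotheses need an action that distinguishes them.
  have hA : Nonempty A := by
    obtain ⟨i, g, hig⟩ := exists_pair_ne H
    obtain ⟨a, -⟩ := hid i g hig
    exact ⟨a⟩
  obtain ⟨C₁, hC₁, C₃, hC₃, hbound⟩ :=
    ElimTaS.exists_expTime_bound (M := M) hfin hid h v hv hb.le hc.le
  -- The term in `log² (1 + L)` is not needed, so any positive coefficient will do.
  refine ⟨fun _ => C₁, fun _ => 1, fun _ => C₃, fun _ => ⟨hC₁, one_pos, hC₃⟩, ?_⟩
  intro α hα0 hα1 δ hδ0 hδ1 Ω _ P _ X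
  have hD := M.baseRate_pos hid h
  have hL : 0 ≤ Real.log (1 / δ) := Real.log_nonneg ((one_le_div hδ0).2 hδ1.le)
  have hlogL : 0 ≤ Real.log (1 + Real.log (1 / δ)) := Real.log_nonneg (by linarith)
  have hchain : ∀ σ : ElimChain h,
      X.expTime (X.chainEvent σ) ≤ ENNReal.ofReal
        (P.real (X.chainEvent σ) *
            (α * Real.log (1 / δ) / M.baseRate h
              + b / M.baseRate h * Real.log (1 + Real.log (1 / δ))
              + C₁ * √(Real.log (1 / δ) * Real.log (1 + Real.log (1 / δ)))
              + 1 * Real.log (1 + Real.log (1 / δ)) ^ 2)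
          + C₃) := fun σ => by
    refine (hbound α hα0 hα1 δ hδ0 hδ1 Ω P X _ (X.measurableSet_chainEvent σ) ?_).trans
      (ENNReal.ofReal_le_ofReal ?_)
    · rintro ω ⟨T, -, -, hend, -⟩
      rw [ElimTaS.τ, hend]
      exact ENat.natCast_ne_top _
    · have h1 : 0 ≤ b / M.baseRate h * Real.log (1 + Real.log (1 / δ)) := by positivity
      have h2 : 0 ≤ Real.log (1 + Real.log (1 / δ)) ^ 2 := by positivity
      gcongr ?_ * ?_ + _
      linarith
  refine ⟨fun _ _ => X.disjoint_chainEvent, hchain, fun F =>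
    ⟨X.measureReal_corrEvent F, X.expTime_corrEvent F, ?_⟩⟩
  rw [X.expTime_corrEvent F, X.measureReal_corrEvent F]
  refine (Finset.sum_le_sum fun σ _ => hchain σ).trans (le_of_eq ?_)
  rw [← ENNReal.ofReal_sum_of_nonneg fun σ _ => by positivity]
  congr 1
  rw [Finset.sum_mul, ← Finset.sum_add_distrib, ← Finset.sum_add_distrib,
    ← Finset.sum_add_distrib]
  exact Finset.sum_congr rfl fun σ _ => by ring
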